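/- For $i=1,2$, let $\mathcal C_i=(M_i,g_i,J_i)$ be an almost Hermitian manifold, i.e. a smooth Riemannian manifold $(M_i,g_i)$ with a smooth almost complex structure $J_i$ satisfying $g_i(J_ix,J_iy)=g_i(x,y)$. Let $\nabla$ be the Levi-Civita connection, $\mathcal R(x,y)=\nabla_x\nabla_y-\nabla_y\nabla_x-\nabla_{[x,y]}$ the curvature operator, $R(x,y,z,w)=g(\mathcal R(x,y)z,w)$ the curvature tensor, and $\mathcal J(x):y\mapsto\mathcal R(y,x)x$ the Jacobi operator. A complex line at a point is a $2$-dimensional real subspace $\pi$ of the tangent space with $J\pi=\pi$; its complex Jacobi operator and complex curvature operator are $$\mathcal J(\pi)=\mathcal J(x)+\mathcal J(Jx),\qquad \mathcal R(\pi)=\mathcal R(x,Jx)$$ for any unit vector $x\in\pi$ (they do not depend on the choice of $x$). Assume that each $\mathcal C_i$ is either Hermitian, i.e. $[X,Y]+J[JX,Y]+J[X,JY]-[JX,JY]=0$ for all vector fields $X,Y$, or nearly Kähler, i.e. $(\nabla_xJ)x=0$ for all tangent vectors $x$. Let $P\in M_1$, $Q\in M_2$, and let $\theta:T_PM_1\to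 T_QM_2$ be a complex isometry, i.e. a linear isometric isomorphism with $\theta J_1=J_2\theta$. Then the following assertions are equivalent: 1. $\theta\,\mathcal J_{\mathcal C_1,P}(\pi)=\mathcal J_{\mathcal C_2,Q}(\theta\pi)\,\theta$ for all complex lines $\pi$ in $T_PM_1$. 2. $\theta\,\mathcal R_{\mathcal C_1,P}(\pi)=\mathcal R_{\mathcal C_2,Q}(\theta\pi)\,\theta$ for all complex lines $\pi$ in $T_PM_1$. 3. $\theta^*R_{\mathcal C_2,Q}=R_{\mathcal C_1,P}$, i.e. $R_{\mathcal C_2,Q}(\theta x,\theta y,\theta z,\theta w)=R_{\mathcal C_1,P}(x,y,z,w)$ for all $x,y,z,w\in T_PM_1$. -/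

import Mathlib

open Bundle
open scoped Manifold ContDiff

namespace AlmostHermitian

section LeviCivita

variable {E : Type*} [NormedAddCommGroup E] [NormedSpace ℝ E]
  {H : Type*} [TopologicalSpace H] {I : ModelWithCorners ℝ E H}
  {M : Type*} [TopologicalSpace M] [ChartedSpace H M] [IsManifold I ∞ M]
  [RiemannianBundle (fun x : M ↦ TangentSpace I x)]
  [IsContMDiffRiemannianBundle I ∞ E (fun x : M ↦ TangentSpace I x)]

lemma mdiffAt_inner {X Y : Π x : M, TangentSpace I x} {p : M}
    (hX : MDiffAt (T% X) p) (hY : MDiffAt (T% Y) p) :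
    MDiffAt (fun q : M ↦ inner ℝ (X q) (Y q)) p :=
  MDifferentiableAt.inner_bundle (E := fun x : M ↦ TangentSpace I x) (b := id) (v := X) (w := Y)
    hX hY

/-- The right-hand side of the Koszul formula: half of
`X⟨Y, Z⟩ + Y⟨X, Z⟩ - Z⟨X, Y⟩ + ⟨[X, Y], Z⟩ - ⟨[X, Z], Y⟩ - ⟨[Y, Z], X⟩`. -/
noncomputable def koszul (X Y Z : Π x : M, TangentSpace I x) (p : M) : ℝ :=
  (d% (fun q : M ↦ inner ℝ (Y q) (Z q)) p (X p) + d% (fun q : M ↦ inner ℝ (X q) (Z q)) p (Y p)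
    - d% (fun q : M ↦ inner ℝ (X q) (Y q)) p (Z p)
    + inner ℝ (VectorField.mlieBracket I X Y p) (Z p)
    - inner ℝ (VectorField.mlieBracket I X Z p) (Y p)
    - inner ℝ (VectorField.mlieBracket I Y Z p) (X p)) / 2

variable [CompleteSpace E]

lemma koszul_tensorial_left {Y Z : Π x : M, TangentSpace I x} {p : M}
    (hY : MDiffAt (T% Y) p) (hZ : MDiffAt (T% Z) p) :
    TensorialAt I E (fun X ↦ koszul X Y Z p) p where
  smul {f X} hf hX := by
    have h1 := mvfderiv_fun_mul hf (mdiffAt_inner hX hZ)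
    have h2 := mvfderiv_fun_mul hf (mdiffAt_inner hX hY)
    simp [koszul, real_inner_smul_left, real_inner_smul_right, h1, h2,
      VectorField.mlieBracket_smul_left hf hX, inner_add_left, inner_neg_left, -mul_eq_mul_left_iff]
    simp only [real_inner_comm]
    ring
  add {X X'} hX hX' := by
    have h1 := mvfderiv_fun_add (mdiffAt_inner hX hZ) (mdiffAt_inner hX' hZ)
    have h2 := mvfderiv_fun_add (mdiffAt_inner hX hY) (mdiffAt_inner hX' hY)
    simp [koszul, inner_add_left, inner_add_right, h1, h2, VectorField.mlieBracket_add_left hX hX']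
    ring

lemma koszul_tensorial_right {X Y : Π x : M, TangentSpace I x} {p : M}
    (hX : MDiffAt (T% X) p) (hY : MDiffAt (T% Y) p) :
    TensorialAt I E (fun Z ↦ koszul X Y Z p) p where
  smul {f Z} hf hZ := by
    have h1 := mvfderiv_fun_mul hf (mdiffAt_inner hY hZ)
    have h2 := mvfderiv_fun_mul hf (mdiffAt_inner hX hZ)
    simp [koszul, real_inner_smul_left, real_inner_smul_right, h1, h2,
      VectorField.mlieBracket_smul_right hf hZ, inner_add_left]
    simp only [real_inner_comm]
    ring
  add {Z Z'} hZ hZ' := by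
    have h1 := mvfderiv_fun_add (mdiffAt_inner hY hZ) (mdiffAt_inner hY hZ')
    have h2 := mvfderiv_fun_add (mdiffAt_inner hX hZ) (mdiffAt_inner hX hZ')
    simp [koszul, inner_add_left, inner_add_right, h1, h2, VectorField.mlieBracket_add_right hZ hZ']
    ring

lemma koszul_add {X Y Y' Z : Π x : M, TangentSpace I x} {p : M}
    (hX : MDiffAt (T% X) p) (hY : MDiffAt (T% Y) p) (hY' : MDiffAt (T% Y') p)
    (hZ : MDiffAt (T% Z) p) :
    koszul X (Y + Y') Z p = koszul X Y Z p + koszul X Y' Z p := by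
  have h1 := mvfderiv_fun_add (mdiffAt_inner hY hZ) (mdiffAt_inner hY' hZ)
  have h2 := mvfderiv_fun_add (mdiffAt_inner hX hY) (mdiffAt_inner hX hY')
  simp [koszul, inner_add_left, inner_add_right, h1, h2, VectorField.mlieBracket_add_left hY hY',
    VectorField.mlieBracket_add_right hY hY']
  ring

lemma koszul_leibniz {X Y Z : Π x : M, TangentSpace I x} {f : M → ℝ} {p : M}
    (hX : MDiffAt (T% X) p) (hY : MDiffAt (T% Y) p) (hZ : MDiffAt (T% Z) p)
    (hf : MDiffAt f p) :
    koszul X (f • Y) Z p = f p * koszul X Y Z p + d% f p (X p) * inner ℝ (Y p) (Z p) := by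
  have h1 := mvfderiv_fun_mul hf (mdiffAt_inner hY hZ)
  have h2 := mvfderiv_fun_mul hf (mdiffAt_inner hX hY)
  simp [koszul, real_inner_smul_left, real_inner_smul_right, h1, h2, VectorField.mlieBracket_smul_left hf hY,
    VectorField.mlieBracket_smul_right hf hY, inner_add_left]
  simp only [real_inner_comm]
  ring

variable [FiniteDimensional ℝ E]

/-- The Koszul expression of `Y` at `p`, as a bilinear form on the tangent space. -/
noncomputable def koszulForm (Y : Π x : M, TangentSpace I x) (p : M) (hY : MDiffAt (T% Y) p) :
    TangentSpace I p →L[ℝ] TangentSpace I p →L[ℝ] ℝ :=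
  TensorialAt.mkHom₂ (fun X Z ↦ koszul X Y Z p) p
    (fun _ hZ ↦ koszul_tensorial_left hY hZ) (fun _ hX ↦ koszul_tensorial_right hX hY)

lemma koszulForm_apply {X Y Z : Π x : M, TangentSpace I x} {p : M}
    (hX : MDiffAt (T% X) p) (hY : MDiffAt (T% Y) p) (hZ : MDiffAt (T% Z) p) :
    koszulForm Y p hY (X p) (Z p) = koszul X Y Z p :=
  TensorialAt.mkHom₂_apply _ _ hX hZ

open scoped Classical in
/-- `leviCivitaFun Y p v` is the vector `∇_v Y` characterized by the Koszul formula, for a vector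
field `Y` that is differentiable at `p` (and `0` for other `Y`). -/
noncomputable def leviCivitaFun (Y : Π x : M, TangentSpace I x) (p : M) :
    TangentSpace I p →L[ℝ] TangentSpace I p :=
  if hY : MDiffAt (T% Y) p then
    have : FiniteDimensional ℝ (TangentSpace I p) := inferInstanceAs (FiniteDimensional ℝ E)
    LinearMap.toContinuousLinearMap
      { toFun := fun v ↦ (InnerProductSpace.toDual ℝ (TangentSpace I p)).symm (koszulForm Y p hY v)
        map_add' := fun v w ↦ by simp
        map_smul' := fun c v ↦ by simp }
  else 0

lemma inner_leviCivitaFun {X Y Z : Π x : M, TangentSpace I x} {p : M}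
    (hX : MDiffAt (T% X) p) (hY : MDiffAt (T% Y) p) (hZ : MDiffAt (T% Z) p) :
    inner ℝ (leviCivitaFun Y p (X p)) (Z p) = koszul X Y Z p := by
  rw [← koszulForm_apply hX hY hZ]
  simp [leviCivitaFun, hY]

lemma clm_ext_of_inner {p : M} {A B : TangentSpace I p →L[ℝ] TangentSpace I p}
    (h : ∀ X Z : Π x : M, TangentSpace I x, MDiffAt (T% X) p → MDiffAt (T% Z) p →
      inner ℝ (A (X p)) (Z p) = inner ℝ (B (X p)) (Z p)) : A = B := by
  ext v
  refine ext_inner_right ℝ fun w ↦ ?_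
  simpa using h (FiberBundle.extend E v) (FiberBundle.extend E w)
    (FiberBundle.mdifferentiableAt_extend ..) (FiberBundle.mdifferentiableAt_extend ..)

variable (I M) in
/-- The Levi-Civita connection of a Riemannian manifold, in Mathlib's convention for the argument
order: `leviCivita I M Y p v` is `(∇_v Y)(p)`. -/
noncomputable def leviCivita : CovariantDerivative I E (fun x : M ↦ TangentSpace I x) where
  toFun := leviCivitaFun
  isCovariantDerivativeOnUniv :=
    { add := fun {Y Y' p} hY hY' _ ↦ clm_ext_of_inner fun X Z hX hZ ↦ by
        simp only [add_apply, inner_add_left]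
        rw [inner_leviCivitaFun hX hY hZ, inner_leviCivitaFun hX hY' hZ,
          inner_leviCivitaFun hX (mdifferentiableAt_add_section hY hY') hZ, koszul_add hX hY hY' hZ]
      leibniz := fun {Y f p} hY hf _ ↦ clm_ext_of_inner fun X Z hX hZ ↦ by
        simp only [add_apply, smul_apply,
          ContinuousLinearMap.smulRight_apply, inner_add_left, real_inner_smul_left]
        rw [inner_leviCivitaFun hX hY hZ,
          inner_leviCivitaFun hX (hf.smul_section hY) hZ, koszul_leibniz hX hY hZ hf] }

theorem inner_leviCivita {X Y Z : Π x : M, TangentSpace I x} {p : M}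
    (hX : MDiffAt (T% X) p) (hY : MDiffAt (T% Y) p) (hZ : MDiffAt (T% Z) p) :
    inner ℝ (leviCivita I M Y p (X p)) (Z p) = koszul X Y Z p :=
  inner_leviCivitaFun hX hY hZ

/-- The Levi-Civita connection is torsion free. -/
theorem leviCivita_torsion : (leviCivita I M).torsion = 0 := by
  rw [CovariantDerivative.torsion_eq_zero_iff]
  intro X Y p hX hY
  refine ext_inner_right ℝ fun w ↦ ?_
  have hw := FiberBundle.mdifferentiableAt_extend I E w
  have h1 := inner_leviCivita hX hY hw
  have h2 := inner_leviCivita hY hX hw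
  simp only [FiberBundle.extend_apply_self] at h1 h2
  rw [inner_sub_left, h1, h2, koszul, koszul, VectorField.mlieBracket_swap_apply (V := Y) (W := X)]
  simp [real_inner_comm]
  ring

/-- The Levi-Civita connection is compatible with the metric. -/
theorem leviCivita_metricCompatible {X Y Z : Π x : M, TangentSpace I x} {p : M}
    (hX : MDiffAt (T% X) p) (hY : MDiffAt (T% Y) p) (hZ : MDiffAt (T% Z) p) :
    d% (fun q : M ↦ inner ℝ (Y q) (Z q)) p (X p) =
      inner ℝ (leviCivita I M Y p (X p)) (Z p) + inner ℝ (Y p) (leviCivita I M Z p (X p)) := by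
  rw [real_inner_comm (leviCivita I M Z p (X p)), inner_leviCivita hX hY hZ,
    inner_leviCivita hX hZ hY, koszul, koszul, VectorField.mlieBracket_swap_apply (V := Z) (W := Y)]
  simp [real_inner_comm]
  ring

end LeviCivita

section Curvature

variable {E : Type*} [NormedAddCommGroup E] [NormedSpace ℝ E]
  [FiniteDimensional ℝ E] [CompleteSpace E]
  {H : Type*} [TopologicalSpace H] {I : ModelWithCorners ℝ E H}
  {M : Type*} [TopologicalSpace M] [ChartedSpace H M] [IsManifold I ∞ M]
  [RiemannianBundle (fun x : M ↦ TangentSpace I x)]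
  [IsContMDiffRiemannianBundle I ∞ E (fun x : M ↦ TangentSpace I x)]

/-- `∇_X ∇_Y Z - ∇_Y ∇_X Z - ∇_[X, Y] Z` at the point `p`, for vector fields `X`, `Y`, `Z`. -/
noncomputable def curvatureField (X Y Z : Π x : M, TangentSpace I x) (p : M) : TangentSpace I p :=
  leviCivita I M (fun q ↦ leviCivita I M Z q (Y q)) p (X p)
    - leviCivita I M (fun q ↦ leviCivita I M Z q (X q)) p (Y p)
    - leviCivita I M Z p (VectorField.mlieBracket I X Y p)

/-- The curvature operator `R(x, y)z` on tangent vectors at `p`. As the curvature is tensorial, it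
may be computed from any extensions to vector fields that are smooth near `p`; Mathlib's
`FiberBundle.extend` is such an extension. -/
noncomputable def curvatureOp (p : M) (x y z : TangentSpace I p) : TangentSpace I p :=
  curvatureField (FiberBundle.extend E x) (FiberBundle.extend E y) (FiberBundle.extend E z) p

/-- The curvature tensor `R(x, y, z, w) = ⟨R(x, y)z, w⟩` at `p`. -/
noncomputable def curvatureTensor (p : M) (x y z w : TangentSpace I p) : ℝ :=
  inner ℝ (curvatureOp p x y z) w

/-- The Jacobi operator `y ↦ R(y, x)x` at `p`. -/
noncomputable def jacobiOp (p : M) (x y : TangentSpace I p) : TangentSpace I p :=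
  curvatureOp p y x x

variable (I M) in
/-- A smooth unitary almost complex structure on a Riemannian manifold. -/
structure UnitaryAlmostComplexStructure where
  /-- The endomorphism of each tangent space. -/
  J (p : M) : TangentSpace I p →L[ℝ] TangentSpace I p
  contMDiff_J : ContMDiff I (I.prod 𝓘(ℝ, E →L[ℝ] E)) ∞
    (fun p : M ↦ TotalSpace.mk' (E →L[ℝ] E)
      (E := fun p : M ↦ TangentSpace I p →L[ℝ] TangentSpace I p) p (J p))
  J_J (p : M) (v : TangentSpace I p) : J p (J p v) = -v
  inner_J_J (p : M) (v w : TangentSpace I p) : inner ℝ (J p v) (J p w) = inner ℝ v w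

namespace UnitaryAlmostComplexStructure

variable (𝓙 : UnitaryAlmostComplexStructure I M)

/-- The vector field `JX`. -/
noncomputable def onField (X : Π x : M, TangentSpace I x) (p : M) : TangentSpace I p := 𝓙.J p (X p)

/-- The Nijenhuis tensor `[X, Y] + J[JX, Y] + J[X, JY] - [JX, JY]` at `p`. -/
noncomputable def nijenhuis (X Y : Π x : M, TangentSpace I x) (p : M) : TangentSpace I p :=
  VectorField.mlieBracket I X Y p
    + 𝓙.J p (VectorField.mlieBracket I (𝓙.onField X) Y p)
    + 𝓙.J p (VectorField.mlieBracket I X (𝓙.onField Y) p)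
    - VectorField.mlieBracket I (𝓙.onField X) (𝓙.onField Y) p

/-- The manifold is Hermitian: the Nijenhuis tensor vanishes at every point `p`, for all vector
fields that are smooth at `p`. -/
def IsHermitian : Prop :=
  ∀ (p : M) (X Y : Π x : M, TangentSpace I x),
    CMDiffAt ∞ (T% X) p → CMDiffAt ∞ (T% Y) p → 𝓙.nijenhuis X Y p = 0

/-- `(∇_X J)Y = ∇_X (JY) - J ∇_X Y` at `p`. -/
noncomputable def covDerivJ (X Y : Π x : M, TangentSpace I x) (p : M) : TangentSpace I p :=
  leviCivita I M (𝓙.onField Y) p (X p) - 𝓙.J p (leviCivita I M Y p (X p))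

/-- The manifold is nearly Kähler: `(∇_x J)x = 0` for all tangent vectors `x`. The vector `x` at `p`
is given as the value at `p` of a vector field `X` that is smooth at `p`. -/
def IsNearlyKahler : Prop :=
  ∀ (p : M) (X : Π x : M, TangentSpace I x), CMDiffAt ∞ (T% X) p → 𝓙.covDerivJ X X p = 0

/-- A complex line at `p`: a `2`-dimensional real subspace `L` of the tangent space with
`JL = L`. -/
def IsComplexLine (p : M) (L : Submodule ℝ (TangentSpace I p)) : Prop :=
  Module.finrank ℝ L = 2 ∧ L.map (𝓙.J p : TangentSpace I p →ₗ[ℝ] TangentSpace I p) = L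

end UnitaryAlmostComplexStructure

/-- Some unit vector of the subspace `L`, if there is one. -/
noncomputable def unitVector {p : M} (L : Submodule ℝ (TangentSpace I p)) : TangentSpace I p :=
  Classical.epsilon fun x ↦ x ∈ L ∧ ‖x‖ = 1

namespace UnitaryAlmostComplexStructure

variable (𝓙 : UnitaryAlmostComplexStructure I M)

/-- The complex Jacobi operator `J(x) + J(Jx)` of a complex line `L`, where `x` is a unit vector
of `L`; it does not depend on `x`. -/
noncomputable def complexJacobiOp (p : M) (L : Submodule ℝ (TangentSpace I p))
    (y : TangentSpace I p) : TangentSpace I p :=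
  jacobiOp p (unitVector L) y + jacobiOp p (𝓙.J p (unitVector L)) y

/-- The complex curvature operator `R(x, Jx)` of a complex line `L`, where `x` is a unit vector
of `L`; it does not depend on `x`. -/
noncomputable def complexCurvatureOp (p : M) (L : Submodule ℝ (TangentSpace I p))
    (y : TangentSpace I p) : TangentSpace I p :=
  curvatureOp p (unitVector L) (𝓙.J p (unitVector L)) y

end UnitaryAlmostComplexStructure

end Curvature

end AlmostHermitian

/-! Both families of complex operators are linear in the curvature tensor, so the theorem amounts to
a vanishing statement for one tensor `R`, the difference of `θ^*R₂` and `R₁`: if all `R(x, Jx)`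
vanish, or all sums of Jacobi operators at `x` and `Jx` vanish, then `R = 0`.

Besides the usual curvature symmetries this uses the Gray identity: the complexification of `R`
vanishes on four vectors of type `(1, 0)`. Polarising the hypothesis tells how `R` changes when `J`
enters both slots of one pair; the Gray identity then tells what happens when `J` enters one slot of
each pair. Comparing the Bianchi identity at `x, y, z` with the one at `Jx, Jy, z` leaves `R = 0`
(`eq_zero_of_complexCurvature`). For Jacobi operators the same argument runs on the symmetrised
curvature tensor (`eq_zero_of_complexJacobi`).

The Gray identity comes from the geometry. In the Hermitian case the `(1, 0)`-fields are closed
under covariant differentiation along each other, so the curvature of `(1, 0)`-vectors sends `(1,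
0)`-vectors to `(1, 0)`-vectors, which are isotropic. In the nearly Kähler case `∇J` is a `3`-form
and the commutator of `J` with the curvature alternates its covariant derivative; the curvature
symmetries allow this only if the Gray defect is zero. Both computations are done with global smooth
fields, and tensoriality carries the result to tangent vectors. -/

namespace AlmostHermitian

/-! ### Linear algebra of curvature tensors with the Gray identity -/

section CurvatureLike

variable {V : Type*} [AddCommGroup V] [Module ℝ V]

/-- The symmetries of a curvature tensor: skew in the first and in the last two arguments, with the
first Bianchi identity. -/
structure CurvatureSymmetries (R : V → V → V → V → ℝ) : Prop where
  skew_left (x y z w : V) : R x y z w = -R y x z w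
  skew_right (x y z w : V) : R x y z w = -R x y w z
  bianchi (x y z w : V) : R x y z w + R y z x w + R z x y w = 0

/-- The defect of the Gray identity, which is the real part of the complexified tensor on the
`(1, 0)`-parts of the arguments. -/
def grayDefect (J : V →ₗ[ℝ] V) (R : V → V → V → V → ℝ) (x y z w : V) : ℝ :=
  R x y z w + R (J x) (J y) (J z) (J w) - R (J x) (J y) z w - R (J x) y (J z) w
    - R (J x) y z (J w) - R x (J y) (J z) w - R x (J y) z (J w) - R x y (J z) (J w)

namespace CurvatureSymmetries

-- The octahedron argument: in `b1 + b2 - b3 - b4` everything cancels by skewness except twice the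
-- difference of the two sides.
omit [AddCommGroup V] [Module ℝ V] in
theorem pair_symm {R : V → V → V → V → ℝ} (h : CurvatureSymmetries R) (x y z w : V) :
    R x y z w = R z w x y := by
  have b1 := h.bianchi x y z w
  have b2 := h.bianchi y z w x
  have b3 := h.bianchi z w x y
  have b4 := h.bianchi w x y z
  have s1 := h.skew_right y z w x
  have s2 := h.skew_left z w y x
  have s3 := h.skew_right z w y x
  have s4 := h.skew_left w y z x
  have s5 := h.skew_left w x z y
  have s6 := h.skew_right x w z y
  have s7 := h.skew_left x z w y
  have s8 := h.skew_left w x y z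
  have s9 := h.skew_right x y w z
  have s10 := h.skew_right y w x z
  have s11 := h.skew_right z x w y
  linarith

omit [AddCommGroup V] [Module ℝ V] in
/-- A tensor with the symmetries of a curvature tensor that is the alternation of a tensor which is
skew in its last three arguments vanishes. -/
theorem eq_zero_of_alternation {K a : V → V → V → V → ℝ} (h : CurvatureSymmetries K)
    (ha₂₃ : ∀ x y z w, a x y z w = -a x z y w) (ha₃₄ : ∀ x y z w, a x y z w = -a x y w z)
    (hK : ∀ x y z w, K x y z w = a x y z w - a y x z w) (x y z w : V) : K x y z w = 0 := by
  have b1 := h.bianchi x y z w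
  have b2 := h.bianchi x y w z
  have p := h.pair_symm x y z w
  -- By skewness `a` has, up to sign, one value for each first argument: `α = a x y z w`, `β = a y x
  -- z w`, `γ = a z x y w`, `δ = a w x y z`. Then `K = α - β`, the two Bianchi identities give `γ =
  -- -K` and `δ = K`, and pair symmetry reads `K = γ - δ = -2K`.
  simp only [hK] at b1 b2 p ⊢
  linarith [ha₂₃ y z x w, ha₂₃ x z y w, ha₂₃ z y x w, ha₃₄ x y w z, ha₃₄ y x w z, ha₂₃ y w x z,
    ha₃₄ w y x z, ha₂₃ w y x z, ha₂₃ w x y z, ha₂₃ x w y z, ha₃₄ z x y w, ha₂₃ z w x y,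
    ha₂₃ w z x y, ha₃₄ w x z y, ha₃₄ z x w y]

/-- The Gray identity for a curvature tensor whose derivation action on `J` is the alternation of
a tensor which is skew in its last three arguments. -/
theorem grayDefect_eq_zero_of_alternation {J : V →ₗ[ℝ] V} (hJ : ∀ x, J (J x) = -x)
    {R a : V → V → V → V → ℝ} (h : CurvatureSymmetries R)
    (hR : ∀ x y z w, R (-x) y z w = -R x y z w)
    (ha₂₃ : ∀ x y z w, a x y z w = -a x z y w) (ha₃₄ : ∀ x y z w, a x y z w = -a x y w z)
    (hRa : ∀ x y z w, R x y (J z) w + R x y z (J w) = a x y z w - a y x z w) (x y z w : V) :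
    grayDefect J R x y z w = 0 := by
  have hR₂ (x y z w) : R x (-y) z w = -R x y z w := by
    rw [h.skew_left, hR, h.skew_left x, neg_neg]
  have hR₃ (x y z w) : R x y (-z) w = -R x y z w := by
    rw [h.pair_symm, hR, h.pair_symm z]
  have hR₄ (x y z w) : R x y z (-w) = -R x y z w := by
    rw [h.skew_right, hR₃, h.skew_right x y w, neg_neg]
  -- On `(1, 0)`-parts `J` is multiplication by `i`, so it may be moved between slots.
  have hJR (x y z w) : grayDefect J R x y (J z) w = grayDefect J R x y z (J w) := by
    simp only [grayDefect, hJ, hR₃, hR₄]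
    ring
  have sl (x y z w) : grayDefect J R x y z w = -grayDefect J R y x z w := by
    simp only [grayDefect]
    rw [h.skew_left x, h.skew_left (J x), h.skew_left (J x) (J y) z w, h.skew_left (J x) y (J z),
      h.skew_left (J x) y z, h.skew_left x (J y) (J z), h.skew_left x (J y) z,
      h.skew_left x y (J z)]
    ring
  have sr (x y z w) : grayDefect J R x y z w = -grayDefect J R x y w z := by
    simp only [grayDefect]
    rw [h.skew_right x y z w, h.skew_right _ _ (J z) (J w), h.skew_right (J x) (J y) z w,
      h.skew_right (J x) y (J z), h.skew_right (J x) y z, h.skew_right x (J y) (J z),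
      h.skew_right x (J y) z, h.skew_right x y (J z)]
    ring
  have bi (x y z w) :
      grayDefect J R x y z w + grayDefect J R y z x w + grayDefect J R z x y w = 0 := by
    simp only [grayDefect]
    linarith [h.bianchi x y z w, h.bianchi (J x) (J y) (J z) (J w), h.bianchi (J x) (J y) z w,
      h.bianchi (J x) y (J z) w, h.bianchi (J x) y z (J w), h.bianchi x (J y) (J z) w,
      h.bianchi x (J y) z (J w), h.bianchi x y (J z) (J w)]
  have hK : CurvatureSymmetries fun x y z w ↦ grayDefect J R x y z (J w) :=
    ⟨fun x y z w ↦ sl x y z (J w), fun x y z w ↦ by rw [sr, hJR], fun x y z w ↦ bi x y z (J w)⟩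
  -- Combining `hRa` over the eight terms of the defect yields the defects of `R` with `J` in the
  -- third and in the fourth slot. These agree by `hJR`, which explains the factor one half.
  have key := hK.eq_zero_of_alternation (a := fun x y z w ↦ grayDefect J a x y z w / 2)
    (fun x y z w ↦ by
      simp only [grayDefect]
      linarith [ha₂₃ x y z w, ha₂₃ (J x) (J y) (J z) (J w), ha₂₃ (J x) (J y) z w,
        ha₂₃ (J x) y (J z) w, ha₂₃ (J x) y z (J w), ha₂₃ x (J y) (J z) w,
        ha₂₃ x (J y) z (J w), ha₂₃ x y (J z) (J w)])
    (fun x y z w ↦ by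
      simp only [grayDefect]
      linarith [ha₃₄ x y z w, ha₃₄ (J x) (J y) (J z) (J w), ha₃₄ (J x) (J y) z w,
        ha₃₄ (J x) y (J z) w, ha₃₄ (J x) y z (J w), ha₃₄ x (J y) (J z) w,
        ha₃₄ x (J y) z (J w), ha₃₄ x y (J z) (J w)])
    (fun x y z w ↦ by
      have e := hJR x y z w
      simp only [grayDefect, hJ, hR₃, hR₄] at e ⊢
      have e1 := hRa x y z w
      have e2 := hRa (J x) (J y) (J z) (J w)
      have e3 := hRa (J x) (J y) z w
      have e4 := hRa (J x) y (J z) w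
      have e5 := hRa (J x) y z (J w)
      have e6 := hRa x (J y) (J z) w
      have e7 := hRa x (J y) z (J w)
      have e8 := hRa x y (J z) (J w)
      simp only [hJ, hR₃, hR₄] at e1 e2 e3 e4 e5 e6 e7 e8
      linarith)
  have := key x y z (-J w)
  simpa [hJ] using this

end CurvatureSymmetries

/-- A curvature tensor on a complex vector space that satisfies the Gray identity. -/
structure IsGrayTensor (J : V →ₗ[ℝ] V) (R : V → V → V → V → ℝ) : Prop
    extends CurvatureSymmetries R where
  add_left (x x' y z w : V) : R (x + x') y z w = R x y z w + R x' y z w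
  smul_left (c : ℝ) (x y z w : V) : R (c • x) y z w = c * R x y z w
  gray (x y z w : V) : grayDefect J R x y z w = 0

namespace IsGrayTensor

variable {J : V →ₗ[ℝ] V} {R R' : V → V → V → V → ℝ}

/-- Together with `comp`, this reduces the comparison of two curvature tensors to the vanishing of a
single one. -/
theorem sub (h : IsGrayTensor J R) (h' : IsGrayTensor J R') :
    IsGrayTensor J (fun x y z w ↦ R x y z w - R' x y z w) where
  skew_left x y z w := by linarith [h.skew_left x y z w, h'.skew_left x y z w]
  skew_right x y z w := by linarith [h.skew_right x y z w, h'.skew_right x y z w]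
  bianchi x y z w := by linarith [h.bianchi x y z w, h'.bianchi x y z w]
  add_left x x' y z w := by linarith [h.add_left x x' y z w, h'.add_left x x' y z w]
  smul_left c x y z w := by linarith [h.smul_left c x y z w, h'.smul_left c x y z w]
  gray x y z w := by
    have h1 := h.gray x y z w
    have h2 := h'.gray x y z w
    simp only [grayDefect] at *
    linarith

theorem comp {W : Type*} [AddCommGroup W] [Module ℝ W] {J' : W →ₗ[ℝ] W} (h : IsGrayTensor J R)
    (f : W →ₗ[ℝ] V) (hf : ∀ x, f (J' x) = J (f x)) :
    IsGrayTensor J' (fun x y z w ↦ R (f x) (f y) (f z) (f w)) where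
  skew_left _ _ _ _ := h.skew_left ..
  skew_right _ _ _ _ := h.skew_right ..
  bianchi _ _ _ _ := h.bianchi ..
  add_left _ _ _ _ _ := by rw [map_add, h.add_left]
  smul_left _ _ _ _ _ := by rw [map_smul, h.smul_left]
  gray x y z w := by simpa only [grayDefect, hf] using h.gray (f x) (f y) (f z) (f w)

theorem neg₁ (h : IsGrayTensor J R) (x y z w : V) : R (-x) y z w = -R x y z w := by
  simpa using h.smul_left (-1) x y z w

theorem add₂ (h : IsGrayTensor J R) (x y y' z w : V) :
    R x (y + y') z w = R x y z w + R x y' z w := by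
  rw [h.skew_left, h.add_left, h.skew_left y, h.skew_left y']
  ring

theorem smul₂ (h : IsGrayTensor J R) (c : ℝ) (x y z w : V) : R x (c • y) z w = c * R x y z w := by
  rw [h.skew_left, h.smul_left, h.skew_left y]
  ring

theorem neg₂ (h : IsGrayTensor J R) (x y z w : V) : R x (-y) z w = -R x y z w := by
  simpa using h.smul₂ (-1) x y z w

theorem add₃ (h : IsGrayTensor J R) (x y z z' w : V) :
    R x y (z + z') w = R x y z w + R x y z' w := by
  rw [h.pair_symm, h.add_left, h.pair_symm z, h.pair_symm z']

theorem smul₃ (h : IsGrayTensor J R) (c : ℝ) (x y z w : V) : R x y (c • z) w = c * R x y z w := by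
  rw [h.pair_symm, h.smul_left, h.pair_symm z]

theorem neg₃ (h : IsGrayTensor J R) (x y z w : V) : R x y (-z) w = -R x y z w := by
  simpa using h.smul₃ (-1) x y z w

theorem neg₄ (h : IsGrayTensor J R) (x y z w : V) : R x y z (-w) = -R x y z w := by
  rw [h.skew_right, h.neg₃, h.skew_right x y w, neg_neg]

/-- A Gray tensor is determined by its complex curvature operators. -/
theorem eq_zero_of_complexCurvature (h : IsGrayTensor J R) (hJ : ∀ x, J (J x) = -x)
    (h0 : ∀ x z w, R x (J x) z w = 0) (x y z w : V) : R x y z w = 0 := by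
  -- Polarisation of `R x (J x) = 0`.
  have a (x y z w) : R (J x) y z w = R x (J y) z w := by
    have := h0 (x + y) z w
    rw [map_add, h.add_left, h.add₂, h.add₂, h0, h0] at this
    linarith [h.skew_left (J x) y z w]
  have a' (x y z w) : R (J x) (J y) z w = -R x y z w := by rw [a, hJ, h.neg₂]
  have b (x y z w) : R x y (J z) w = R x y z (J w) := by rw [h.pair_symm, a, h.pair_symm]
  have b' (x y z w) : R x y (J z) (J w) = -R x y z w := by rw [b, hJ, h.neg₄]
  -- The four mixed terms of the Gray identity agree by `a` and `b`; each of the other four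
  -- contributes `R x y z w`.
  have c (x y z w) : R (J x) y (J z) w = R x y z w := by
    have := h.gray x y z w
    simp only [grayDefect, a', b'] at this
    linarith [b (J x) y z w, a x y (J z) w, b x (J y) z w]
  have d := h.bianchi (J x) (J y) z w
  rw [a', c, ← a z x, c] at d
  linarith [h.bianchi x y z w]

/-- A Gray tensor is determined by its complex Jacobi operators. -/
theorem eq_zero_of_complexJacobi (h : IsGrayTensor J R) (hJ : ∀ x, J (J x) = -x)
    (h0 : ∀ x y w, R y x x w + R y (J x) (J x) w = 0) (x y z w : V) : R x y z w = 0 := by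
  -- The polarised Jacobi operator: `S y w x x` is twice `R y x x w`. It is symmetric in each pair
  -- and under exchange of the pairs, and it satisfies a cyclic identity.
  set S : V → V → V → V → ℝ := fun y w x z ↦ R y x z w + R y z x w with hS
  have s₁ (y w x z) : S y w x z = S w y x z := by
    simp only [hS]
    rw [h.pair_symm, h.skew_left, h.skew_right, h.pair_symm y z, h.skew_left x w,
      h.skew_right w x]
    ring
  have s₂ (y w x z) : S y w x z = S y w z x := by simp only [hS]; ring
  have s₃ (y w x z) : S y w x z = S x z y w := by
    simp only [hS]
    rw [h.skew_left y x, h.skew_right x y, h.pair_symm y z, h.skew_left x w, h.skew_right w x,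
      h.pair_symm w x]
    ring
  have bi (y w x z) : S y w x z + S y x w z + S y z x w = 0 := by
    simp only [hS]
    linarith [h.skew_right y x z w, h.skew_right y z x w, h.skew_right y w x z]
  have n₁ (y w x z) : S (-y) w x z = -S y w x z := by simp only [hS, h.neg₁]; ring
  have n₃ (y w x z) : S y w (-x) z = -S y w x z := by rw [s₃, n₁, s₃]
  have j₃ (y w x z) : S y w (J x) (J z) = -S y w x z := by
    have h1 := h0 (x + z) y w
    have h2 := h0 x y w
    have h3 := h0 z y w
    simp only [map_add, h.add₂, h.add₃] at h1
    simp only [hS]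
    linarith
  have k₃ (y w x z) : S y w (J x) z = S y w x (J z) := by
    have := j₃ y w (J x) z
    rw [hJ, n₃] at this
    linarith
  have j₁ (y w x z) : S (J y) (J w) x z = -S y w x z := by rw [s₃, j₃, s₃]
  have k₁ (y w x z) : S (J y) w x z = S y (J w) x z := by rw [s₃, k₃, s₃]
  -- The Gray identities at `y x z w` and `y z x w` add up to the eight-term identity for `S`, which
  -- is then used as in the case of complex curvature operators.
  have c (y w x z) : S (J y) w (J x) z = S y w x z := by
    have g1 := h.gray y x z w
    have g2 := h.gray y z x w
    have e1 := j₁ y w x z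
    have e2 := j₃ y w x z
    have e3 := j₁ y w (J x) (J z)
    have e4 := k₃ (J y) w x z
    have e5 := k₁ y w (J x) z
    have e6 := k₁ y w x (J z)
    simp only [grayDefect, hS] at *
    linarith
  have S0 (y w x z) : S y w x z = 0 := by
    have h1 := bi y w x z
    have h2 := bi (J y) (J w) x z
    rw [j₁, c, s₂ (J y) z x, c, s₂ y z w] at h2
    linarith
  -- The vanishing of `S` makes the three terms of the Bianchi identity equal.
  have h1 := S0 x w y z
  have h2 := S0 x z y w
  have h3 := h.bianchi x y z w
  simp only [hS] at h1 h2
  linarith [h.skew_right x y z w, h.skew_left x z y w, h.pair_symm x w y z]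

end IsGrayTensor

end CurvatureLike

/-! ### The Gray identity from the formal properties of the Levi-Civita connection -/

section ConnectionAlgebra

variable {V A : Type*} [AddCommGroup V] [Module ℝ V] [AddCommGroup A] [Module ℝ A]

/-- The algebraic properties of the Levi-Civita connection `D`, with `V` the space of vector fields,
`A` the space of functions, `δ` the derivative of functions along vector fields, and `g` the metric.
The Lie bracket is expressed by `D X Y - D Y X`. -/
structure IsLeviCivitaAlgebra (D : V →ₗ[ℝ] V →ₗ[ℝ] V) (δ : V → A → A) (g : V →ₗ[ℝ] V →ₗ[ℝ] A) :
    Prop where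
  symm (X Y : V) : g X Y = g Y X
  nondegenerate (X : V) : (∀ Y, g X Y = 0) → X = 0
  compat (X Y Z : V) : δ X (g Y Z) = g (D X Y) Z + g Y (D X Z)
  jacobi (X Y Z : V) : D X (D Y Z - D Z Y) - D (D Y Z - D Z Y) X =
    (D (D X Y - D Y X) Z - D Z (D X Y - D Y X)) + (D Y (D X Z - D Z X) - D (D X Z - D Z X) Y)
  δ_add (X : V) (f h : A) : δ X (f + h) = δ X f + δ X h
  δ_zero (X : V) : δ X 0 = 0
  commutator (X Y : V) (f : A) : δ X (δ Y f) - δ Y (δ X f) = δ (D X Y - D Y X) f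

/-- The curvature operator of a torsion-free connection. -/
def curv (D : V →ₗ[ℝ] V →ₗ[ℝ] V) (X Y Z : V) : V :=
  D X (D Y Z) - D Y (D X Z) - D (D X Y - D Y X) Z

/-- The covariant derivative `(D_X J) Y`. -/
def derivJ (D : V →ₗ[ℝ] V →ₗ[ℝ] V) (J : V →ₗ[ℝ] V) (X Y : V) : V := D X (J Y) - J (D X Y)

namespace IsLeviCivitaAlgebra

variable {D : V →ₗ[ℝ] V →ₗ[ℝ] V} {δ : V → A → A} {g : V →ₗ[ℝ] V →ₗ[ℝ] A}

/-- The commutator of derivations applied to the function `g Z W`, expanded by metric compatibility.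
-/
theorem curv_skew_right (h : IsLeviCivitaAlgebra D δ g) (X Y Z W : V) :
    g (curv D X Y Z) W = -g (curv D X Y W) Z := by
  have c := h.commutator X Y (g Z W)
  simp only [h.compat, h.δ_add] at c
  simp only [curv, map_sub, LinearMap.sub_apply] at c ⊢
  rw [h.symm _ Z, h.symm _ Z, h.symm _ Z, h.symm _ Z]
  linear_combination (norm := module) c

theorem curv_bianchi (h : IsLeviCivitaAlgebra D δ g) (X Y Z : V) :
    curv D X Y Z + curv D Y Z X + curv D Z X Y = 0 := by
  have c := h.jacobi X Y Z
  simp only [curv, map_sub, LinearMap.sub_apply] at c ⊢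
  linear_combination (norm := module) c

theorem curvatureSymmetries (h : IsLeviCivitaAlgebra D δ g) (ev : A →ₗ[ℝ] ℝ) :
    CurvatureSymmetries fun X Y Z W ↦ ev (g (curv D X Y Z) W) where
  skew_left X Y Z W := by
    rw [← map_neg, ← LinearMap.neg_apply, ← map_neg]
    congr 3
    simp only [curv, map_sub, LinearMap.sub_apply]
    module
  skew_right X Y Z W := by rw [← map_neg, h.curv_skew_right]
  bianchi X Y Z W := by
    simp only [← map_add, ← LinearMap.add_apply, h.curv_bianchi, LinearMap.zero_apply,
      map_zero]

section AlmostComplex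

variable {J : V →ₗ[ℝ] V}

/-- As a unitary structure with square `-1`, `J` is skew for `g`; differentiating this relation
makes its derivative skew. -/
theorem g_derivJ_right (h : IsLeviCivitaAlgebra D δ g) (hJ : ∀ X, J (J X) = -X)
    (hg : ∀ X Y, g (J X) (J Y) = g X Y) (X Y Z : V) :
    g (derivJ D J X Y) Z = -g (derivJ D J X Z) Y := by
  have e (Y Z : V) : g (J Y) Z = -g Y (J Z) := by
    rw [← hg (J Y), hJ]
    simp
  have c : δ X (g (J Y) Z + g Y (J Z)) = 0 := by
    rw [e, neg_add_cancel, h.δ_zero]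
  simp only [h.δ_add, h.compat] at c
  simp only [derivJ, map_sub, LinearMap.sub_apply, e] at c ⊢
  rw [h.symm Y, h.symm Y, e] at c
  linear_combination (norm := module) c

theorem derivJ_J (hJ : ∀ X, J (J X) = -X) (X Y : V) :
    derivJ D J X (J Y) = -J (derivJ D J X Y) := by
  simp only [derivJ, hJ, map_sub, map_neg]
  module

/-- On a Hermitian manifold, `(∇_{JX} J) Y = J (∇_X J) Y`. -/
theorem derivJ_J_left_of_hermitian (h : IsLeviCivitaAlgebra D δ g) (hJ : ∀ X, J (J X) = -X)
    (hg : ∀ X Y, g (J X) (J Y) = g X Y)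
    (hN : ∀ X Y, (D X Y - D Y X) + J (D (J X) Y - D Y (J X)) + J (D X (J Y) - D (J Y) X)
      - (D (J X) (J Y) - D (J Y) (J X)) = 0) (X Y : V) :
    derivJ D J X Y + J (derivJ D J (J X) Y) = 0 := by
  have e (Y Z : V) : g (J Y) Z = -g Y (J Z) := by
    rw [← hg (J Y), hJ]
    simp
  set E : V → V → V := fun X Y ↦ derivJ D J X Y + J (derivJ D J (J X) Y) with hE
  -- `J` applied to the Nijenhuis tensor is `E Y X - E X Y`.
  have s (X Y : V) : E X Y = E Y X := by
    have := congrArg J (hN X Y)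
    simp only [hE, derivJ, map_sub, map_add, hJ, map_zero] at this ⊢
    linear_combination (norm := module) -this
  have t (X Y Z : V) : g (E X Y) Z = -g (E X Z) Y := by
    simp only [hE, map_add, LinearMap.add_apply, e]
    rw [h.g_derivJ_right hJ hg X Y Z, h.g_derivJ_right hJ hg (J X) Y (J Z), derivJ_J hJ]
    simp only [map_neg, LinearMap.neg_apply, e]
    module
  refine h.nondegenerate _ fun Z ↦ ?_
  change g (E X Y) Z = 0
  -- A trilinear form symmetric in the first two and skew in the last two arguments is zero:
  -- alternating the two swaps three times restores the order and changes the sign.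
  have : g (E X Y) Z = -g (E X Y) Z := by
    conv_lhs => rw [t, s, t, s, t, s]
    simp
  linear_combination (norm := module) (1 / 2 : ℝ) • this

/-- The Gray identity on a Hermitian manifold. -/
theorem grayDefect_eq_zero_of_hermitian (h : IsLeviCivitaAlgebra D δ g) (hJ : ∀ X, J (J X) = -X)
    (hg : ∀ X Y, g (J X) (J Y) = g X Y)
    (hN : ∀ X Y, (D X Y - D Y X) + J (D (J X) Y - D Y (J X)) + J (D X (J Y) - D (J Y) X)
      - (D (J X) (J Y) - D (J Y) (J X)) = 0) (ev : A →ₗ[ℝ] ℝ) (X Y Z W : V) :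
    grayDefect J (fun X Y Z W ↦ ev (g (curv D X Y Z) W)) X Y Z W = 0 := by
  -- The complexified connection takes `X - iJX` and `Y - iJY` to `P X Y - iJ(P X Y)`; this is `q`.
  -- Thus `P` is the connection on `(1, 0)`-fields, and it commutes with `J` by `PJ`.
  set P : V → V → V := fun X Y ↦ D X Y - D (J X) (J Y) with hP
  have q (X Y : V) : D (J X) Y + D X (J Y) = J (P X Y) := by
    have := h.derivJ_J_left_of_hermitian hJ hg hN X Y
    simp only [hP, derivJ, map_sub, hJ] at this ⊢
    linear_combination (norm := module) this
  have PJ (X Y : V) : P X (J Y) = J (P X Y) := by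
    rw [← q]
    simp only [hP, hJ, map_neg]
    module
  -- The curvature on `(1, 0)`-parts is the curvature of `P`, so it inherits commutation with `J` in
  -- `CJ`.
  have C (X Y Z : V) : curv D X Y Z - curv D (J X) (J Y) Z - curv D (J X) Y (J Z)
      - curv D X (J Y) (J Z) = P X (P Y Z) - P Y (P X Z) - P (P X Y - P Y X) Z := by
    have PP (X Y Z : V) : P X (P Y Z) = D X (D Y Z) - D X (D (J Y) (J Z))
        - D (J X) (D (J Y) Z) - D (J X) (D Y (J Z)) := by
      change D X (P Y Z) - D (J X) (J (P Y Z)) = _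
      rw [← q]
      simp only [hP, map_sub, map_add]
      module
    have PB : P (P X Y - P Y X) Z = D (P X Y) Z - D (P Y X) Z - D (J (P X Y)) (J Z)
        + D (J (P Y X)) (J Z) := by
      simp only [hP, map_sub, LinearMap.sub_apply]
      module
    rw [PP, PP, PB, ← q, ← q]
    simp only [curv, hP, map_sub, map_add, LinearMap.sub_apply, LinearMap.add_apply]
    module
  have CJ : curv D X Y (J Z) - curv D (J X) (J Y) (J Z) - curv D (J X) Y (J (J Z))
      - curv D X (J Y) (J (J Z)) =
      J (curv D X Y Z - curv D (J X) (J Y) Z - curv D (J X) Y (J Z) - curv D X (J Y) (J Z)) := by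
    rw [C, C]
    simp only [PJ, map_sub]
  have n (X Y Z : V) : curv D X Y (-Z) = -curv D X Y Z := by
    simp only [curv, map_neg]
    module
  have key := congrArg (fun U ↦ ev (g U (J W))) CJ
  simp only [hg, hJ, n, map_sub, map_neg, LinearMap.sub_apply, LinearMap.neg_apply] at key
  simp only [grayDefect]
  linarith

/-- The Gray identity on a nearly Kähler manifold. -/
theorem grayDefect_eq_zero_of_nearlyKahler (h : IsLeviCivitaAlgebra D δ g)
    (hJ : ∀ X, J (J X) = -X) (hg : ∀ X Y, g (J X) (J Y) = g X Y)
    (hK : ∀ X, derivJ D J X X = 0) (ev : A →ₗ[ℝ] ℝ) (X Y Z W : V) :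
    grayDefect J (fun X Y Z W ↦ ev (g (curv D X Y Z) W)) X Y Z W = 0 := by
  set B := derivJ D J with hB
  have B₁ (X Y : V) : B X Y = -B Y X := by
    have := hK (X + Y)
    have h1 := hK X
    have h2 := hK Y
    simp only [hB, derivJ, map_add, LinearMap.add_apply] at *
    linear_combination (norm := module) this - h1 - h2
  have e (Y Z : V) : g (J Y) Z = -g Y (J Z) := by
    rw [← hg (J Y), hJ]
    simp
  have B₂ (X Y Z : V) : g (B X Y) Z = -g (B X Z) Y := h.g_derivJ_right hJ hg X Y Z
  -- Here `a` is the covariant derivative of the `3`-form `g (B Y Z) W`, hence still skew in the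
  -- last three arguments; its alternation in the first two is the Ricci identity for `J`.
  refine (h.curvatureSymmetries ev).grayDefect_eq_zero_of_alternation hJ
    (a := fun X Y Z W ↦ ev (g (D X (B Y Z)) W - g (B (D X Y) Z) W - g (B Y (D X Z)) W))
    ?_ ?_ ?_ ?_ X Y Z W
  · intro X Y Z W
    rw [← map_neg, ← LinearMap.neg_apply, ← map_neg]
    congr 3
    simp only [curv, map_sub, map_neg, LinearMap.sub_apply, LinearMap.neg_apply]
    module
  · intro X Y Z W
    rw [← map_neg]
    congr 1
    rw [B₁ Y Z, B₁ (D X Y) Z, B₁ Y (D X Z)]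
    simp only [map_neg, LinearMap.neg_apply]
    module
  · intro X Y Z W
    rw [← map_neg]
    congr 1
    have c := congrArg (δ X) (show g (B Y Z) W + g (B Y W) Z = 0 by rw [B₂]; module)
    rw [h.δ_add, h.compat, h.compat, h.δ_zero] at c
    linear_combination (norm := module) c - B₂ (D X Y) Z W - B₂ Y (D X Z) W - B₂ Y (D X W) Z
  · intro X Y Z W
    have : g (curv D X Y (J Z)) W + g (curv D X Y Z) (J W) =
        (g (D X (B Y Z)) W - g (B (D X Y) Z) W - g (B Y (D X Z)) W)
        - (g (D Y (B X Z)) W - g (B (D Y X) Z) W - g (B X (D Y Z)) W) := by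
      rw [← neg_eq_iff_eq_neg.2 (e (curv D X Y Z) W)]
      simp only [hB, derivJ, curv, map_sub, LinearMap.sub_apply]
      module
    simpa only [map_add, map_sub] using congrArg ev this

end AlmostComplex

end IsLeviCivitaAlgebra

end ConnectionAlgebra

/-! ### Global smooth fields, brackets and tensoriality -/

section SmoothFields

open Topology VectorField

variable {E : Type*} [NormedAddCommGroup E] [NormedSpace ℝ E]
  {H : Type*} [TopologicalSpace H] {I : ModelWithCorners ℝ E H}
  {M : Type*} [TopologicalSpace M] [ChartedSpace H M] [IsManifold I ∞ M]

theorem le_infty (n : ℕ) [n.AtLeastTwo] : (ofNat(n) : ℕ∞ω) ≤ ∞ :=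
  WithTop.coe_le_coe.2 le_top

/-- The derivative of a smooth function along a smooth vector field is smooth. -/
theorem contMDiff_mvfderiv_apply {f : M → ℝ} {X : Π x : M, TangentSpace I x}
    (hf : CMDiff ∞ f) (hX : CMDiff ∞ (T% X)) : CMDiff ∞ (fun q ↦ d% f q (X q)) := by
  have h := (hf.contMDiff_tangentMap (m := ∞) le_rfl).comp hX
  exact (contMDiff_snd_tangentBundle_modelSpace ℝ 𝓘(ℝ, ℝ)).comp h

theorem contMDiff_mlieBracket [CompleteSpace E] {X Y : Π x : M, TangentSpace I x}
    (hX : CMDiff ∞ (T% X)) (hY : CMDiff ∞ (T% Y)) : CMDiff ∞ (T% (mlieBracket I X Y)) := by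
  have : IsManifold I (((⊤ : ℕ∞) : ℕ∞ω) + 1) M := inferInstanceAs (IsManifold I ∞ M)
  have : IsManifold I (minSmoothness ℝ 2) M := IsManifold.of_le (n := ∞) (by simpa using le_infty 2)
  exact ContDiff.mlieBracket_vectorField (m := ⊤) (n := ⊤) hX hY (by simp)

section Extension

variable [FiniteDimensional ℝ E] [T2Space M]

/-- A section that is smooth near a point agrees near that point with a global smooth section. -/
theorem exists_contMDiff_eventuallyEq {σ : Π x : M, TangentSpace I x} {p : M} {s : Set M}
    (hs : s ∈ 𝓝 p) (hσ : CMDiff[s] ∞ (T% σ)) :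
    ∃ X : Π x : M, TangentSpace I x, CMDiff ∞ (T% X) ∧ ∀ᶠ q in 𝓝 p, X q = σ q := by
  obtain ⟨f, -, hf⟩ := (SmoothBumpFunction.nhds_basis_tsupport (I := I) p).mem_iff.1
    (interior_mem_nhds.2 hs)
  refine ⟨(f : M → ℝ) • σ, ContMDiffOn.smul_section_of_tsupport f.contMDiff.contMDiffOn
    isOpen_interior hf (hσ.mono interior_subset), ?_⟩
  filter_upwards [f.eventuallyEq_one] with q hq
  simp [hq]

/-- `FiberBundle.extend` is guaranteed smooth only near `p`, whereas the algebra of connections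
works with global fields. -/
theorem exists_contMDiff_extend {p : M} (v : TangentSpace I p) :
    ∃ X : Π x : M, TangentSpace I x, CMDiff ∞ (T% X) ∧
      ∀ᶠ q in 𝓝 p, X q = FiberBundle.extend E v q := by
  obtain ⟨s, hs, h⟩ := FiberBundle.exists_contMDiffOn_extend I E (k := ∞) v
  exact exists_contMDiff_eventuallyEq hs h

theorem exists_contMDiff_apply_eq {p : M} (v : TangentSpace I p) :
    ∃ X : Π x : M, TangentSpace I x, CMDiff ∞ (T% X) ∧ X p = v := by
  obtain ⟨X, hX, h⟩ := exists_contMDiff_extend v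
  exact ⟨X, hX, by simpa using h.self_of_nhds⟩

/-- The Lie bracket is the commutator of derivations. -/
theorem mvfderiv_commutator {f : M → ℝ} {X Y : Π x : M, TangentSpace I x}
    (hf : CMDiff ∞ f) (hX : CMDiff ∞ (T% X)) (hY : CMDiff ∞ (T% Y)) (p : M) :
    d% (fun q ↦ d% f q (Y q)) p (X p) - d% (fun q ↦ d% f q (X q)) p (Y p) =
      d% f p (mlieBracket I X Y p) := by
  -- In the Jacobi identity for `X`, `Y`, `f • Z`, the Jacobi identity for `X`, `Y`, `Z` removes all
  -- but a multiple of `Z`, whose coefficient is the wanted difference. A nonzero value of `Z` then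
  -- cancels.
  have key (v : TangentSpace I p) :
      (d% (fun q ↦ d% f q (Y q)) p (X p) - d% (fun q ↦ d% f q (X q)) p (Y p)
        - d% f p (mlieBracket I X Y p)) • v = 0 := by
    obtain ⟨Z, hZ, rfl⟩ := exists_contMDiff_apply_eq v
    have : IsManifold I (minSmoothness ℝ 3) M := IsManifold.of_le (n := ∞) (by simpa using le_infty 3)
    have two : minSmoothness ℝ 2 ≤ ∞ := by simpa using le_infty 2
    have jac {U V W : Π x : M, TangentSpace I x} (hU : CMDiff ∞ (T% U)) (hV : CMDiff ∞ (T% V))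
        (hW : CMDiff ∞ (T% W)) :=
      leibniz_identity_mlieBracket_apply ((hU p).of_le two) ((hV p).of_le two) ((hW p).of_le two)
    have j1 := jac hX hY hZ
    have j2 := jac hX hY (hf.smul_section hZ)
    have hd {g : M → ℝ} (hg : CMDiff ∞ g) (q) : MDiffAt g q := (hg q).mdifferentiableAt (by simp)
    have hs {W : Π x : M, TangentSpace I x} (hW : CMDiff ∞ (T% W)) (q) : MDiffAt (T% W) q :=
      (hW q).mdifferentiableAt (by simp)
    have ex {W : Π x : M, TangentSpace I x} : mlieBracket I W (f • Z) =
        (fun q ↦ d% f q (W q)) • Z + f • mlieBracket I W Z := by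
      funext q
      exact mlieBracket_smul_right (hd hf q) (hs hZ q)
    have sX := contMDiff_mvfderiv_apply hf hX
    have sY := contMDiff_mvfderiv_apply hf hY
    have bX := contMDiff_mlieBracket hX hZ
    have bY := contMDiff_mlieBracket hY hZ
    rw [ex, ex, ex, mlieBracket_add_right (hs (sY.smul_section hZ) p) (hs (hf.smul_section bY) p),
      mlieBracket_add_right (hs (sX.smul_section hZ) p) (hs (hf.smul_section bX) p),
      mlieBracket_smul_right (hd sY p) (hs hZ p), mlieBracket_smul_right (hd sX p) (hs hZ p),
      mlieBracket_smul_right (hd hf p) (hs bY p), mlieBracket_smul_right (hd hf p) (hs bX p)] at j2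
    simp only [Pi.add_apply, Pi.smul_apply', j1] at j2
    linear_combination (norm := module) j2
  rcases subsingleton_or_nontrivial (TangentSpace I p) with h | h
  · simp [Subsingleton.elim _ (0 : TangentSpace I p)]
  · obtain ⟨v, hv⟩ := exists_ne (0 : TangentSpace I p)
    exact sub_eq_zero.1 ((smul_eq_zero.1 (key v)).resolve_right hv)

/-- An operation on smooth vector fields that is additive and linear over the smooth functions
depends only on the value of the vector field at the point. -/
theorem eq_of_tensorial {A : Type*} [AddCommGroup A] [Module ℝ A]
    {Φ : (Π x : M, TangentSpace I x) → A} {p : M}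
    (hadd : ∀ {X Y : Π x : M, TangentSpace I x}, CMDiff ∞ (T% X) → CMDiff ∞ (T% Y) →
      Φ (X + Y) = Φ X + Φ Y)
    (hsmul : ∀ {f : M → ℝ} {X : Π x : M, TangentSpace I x}, CMDiff ∞ f → CMDiff ∞ (T% X) →
      Φ (f • X) = f p • Φ X)
    {X Y : Π x : M, TangentSpace I x} (hX : CMDiff ∞ (T% X)) (hY : CMDiff ∞ (T% Y))
    (hXY : X p = Y p) : Φ X = Φ Y := by
  let t := trivializationAt E (TangentSpace I : M → Type _) p
  let b := Module.finBasis ℝ E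
  obtain ⟨f, -, hf⟩ := (SmoothBumpFunction.nhds_basis_tsupport (I := I) p).mem_iff.1
    (t.open_baseSet.mem_nhds (FiberBundle.mem_baseSet_trivializationAt E _ p))
  have fp : f p = 1 := f.eq_one
  let c (X : Π x : M, TangentSpace I x) (i) : M → ℝ := fun q ↦ t.localFrameCoeff I b i q (X q)
  have smooth_c {X : Π x : M, TangentSpace I x} (hX : CMDiff ∞ (T% X)) (i) :
      CMDiff ∞ ((f : M → ℝ) • c X i) := by
    refine contMDiff_of_tsupport fun q hq ↦ ?_
    have hq' : q ∈ t.baseSet := hf (tsupport_smul_subset_left _ _ hq)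
    exact (f.contMDiff q).smul (contMDiffAt_localFrameCoeff b hq' (hX q) i)
  have smooth_e (i) : CMDiff ∞ (T% ((f : M → ℝ) • t.localFrame b i)) :=
    ContMDiffOn.smul_section_of_tsupport f.contMDiff.contMDiffOn t.open_baseSet hf
      (t.contMDiffOn_localFrame_baseSet ∞ b i)
  have h0 : Φ 0 = 0 := by
    have := hsmul (f := fun _ ↦ 0) (X := 0) contMDiff_const (contMDiff_zeroSection ℝ _)
    simpa using this
  have hsum {ι : Type} (s : Finset ι) (Z : ι → Π x : M, TangentSpace I x)
      (hZ : ∀ i, CMDiff ∞ (T% (Z i))) : Φ (∑ i ∈ s, Z i) = ∑ i ∈ s, Φ (Z i) := by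
    classical
    have : CMDiff ∞ (T% (∑ i ∈ s, Z i)) ∧ Φ (∑ i ∈ s, Z i) = ∑ i ∈ s, Φ (Z i) := by
      induction s using Finset.induction_on with
      | empty => exact ⟨contMDiff_zeroSection ℝ _, by simpa using h0⟩
      | insert a s ha ih =>
        rw [Finset.sum_insert ha, Finset.sum_insert ha, hadd (hZ a) ih.1, ih.2]
        exact ⟨(hZ a).add_section ih.1, rfl⟩
    exact this.2
  have expand {X : Π x : M, TangentSpace I x} (hX : CMDiff ∞ (T% X)) :
      Φ X = ∑ i, c X i p • Φ ((f : M → ℝ) • t.localFrame b i) := by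
    -- One factor `f` makes the coefficients globally smooth, the other the frame; the bump function
    -- is `1` at `p`.
    have e1 : ((f : M → ℝ) * f) • X =
        ∑ i, ((f : M → ℝ) • c X i) • ((f : M → ℝ) • t.localFrame b i) := by
      funext q
      by_cases hq : q ∈ t.baseSet
      · simp only [Pi.smul_apply', Pi.mul_apply, Finset.sum_apply]
        conv_lhs => rw [t.eq_sum_localFrameCoeff_smul (I := I) (b := b) hq (s := X)]
        rw [Finset.smul_sum]
        refine Finset.sum_congr rfl fun i _ ↦ ?_
        simp only [smul_smul, smul_eq_mul, c]
        ring_nf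
      · have : f q = 0 := image_eq_zero_of_notMem_tsupport fun h ↦ hq (hf h)
        simp [this]
    have hff := hsmul (X := X) (f := (f : M → ℝ) * f) (f.contMDiff.mul f.contMDiff) hX
    rw [Pi.mul_apply, fp, mul_one, one_smul, e1, hsum] at hff
    · rw [← hff]
      refine Finset.sum_congr rfl fun i _ ↦ ?_
      rw [hsmul (smooth_c hX i) (smooth_e i)]
      simp
    · exact fun i ↦ (smooth_c hX i).smul_section (smooth_e i)
  rw [expand hX, expand hY]
  simp only [c, hXY]

end Extension

end SmoothFields

/-! ### Smoothness of covariant derivatives and tensoriality of the curvature -/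

section SmoothConnection

open Topology VectorField

variable {E : Type*} [NormedAddCommGroup E] [NormedSpace ℝ E]
  [FiniteDimensional ℝ E] [CompleteSpace E]
  {H : Type*} [TopologicalSpace H] {I : ModelWithCorners ℝ E H}
  {M : Type*} [TopologicalSpace M] [ChartedSpace H M] [IsManifold I ∞ M]
  [RiemannianBundle (fun x : M ↦ TangentSpace I x)]
  [IsContMDiffRiemannianBundle I ∞ E (fun x : M ↦ TangentSpace I x)]

omit [FiniteDimensional ℝ E] [CompleteSpace E] in
theorem contMDiff_inner {X Y : Π x : M, TangentSpace I x}
    (hX : CMDiff ∞ (T% X)) (hY : CMDiff ∞ (T% Y)) :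
    CMDiff ∞ (fun q : M ↦ inner ℝ (X q) (Y q)) :=
  ContMDiff.inner_bundle (E := fun x : M ↦ TangentSpace I x) (b := id) hX hY

omit [FiniteDimensional ℝ E] in
theorem contMDiff_koszul {X Y Z : Π x : M, TangentSpace I x}
    (hX : CMDiff ∞ (T% X)) (hY : CMDiff ∞ (T% Y)) (hZ : CMDiff ∞ (T% Z)) :
    CMDiff ∞ (koszul X Y Z) := by
  have h1 := contMDiff_mvfderiv_apply (contMDiff_inner hY hZ) hX
  have h2 := contMDiff_mvfderiv_apply (contMDiff_inner hX hZ) hY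
  have h3 := contMDiff_mvfderiv_apply (contMDiff_inner hX hY) hZ
  have h4 := contMDiff_inner (contMDiff_mlieBracket hX hY) hZ
  have h5 := contMDiff_inner (contMDiff_mlieBracket hX hZ) hY
  have h6 := contMDiff_inner (contMDiff_mlieBracket hY hZ) hX
  have := ((((((h1.add h2).sub h3).add h4).sub h5).sub h6).div_const 2)
  exact this

omit [IsManifold I ∞ M] [FiniteDimensional ℝ E] [CompleteSpace E]
  [RiemannianBundle (fun x : M ↦ TangentSpace I x)]
  [IsContMDiffRiemannianBundle I ∞ E (fun x : M ↦ TangentSpace I x)] in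
theorem contMDiffAt_det {n : Type*} [Fintype n] [DecidableEq n] {A : M → Matrix n n ℝ} {p : M}
    (hA : ∀ i j, CMDiffAt ∞ (fun q ↦ A q i j) p) : CMDiffAt ∞ (fun q ↦ (A q).det) p := by
  simp only [Matrix.det_apply']
  refine ContMDiffAt.sum fun σ _ ↦ ?_
  exact contMDiffAt_const.mul (contMDiffAt_finsetProd fun i _ ↦ hA _ _)

variable [T2Space M]

/-- The covariant derivative of smooth vector fields is smooth. -/
theorem contMDiff_leviCivita {X Y : Π x : M, TangentSpace I x}
    (hX : CMDiff ∞ (T% X)) (hY : CMDiff ∞ (T% Y)) :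
    CMDiff ∞ (T% (fun q ↦ leviCivita I M Y q (X q))) := by
  intro p
  set Z : Π x : M, TangentSpace I x := fun q ↦ leviCivita I M Y q (X q) with hZ
  let t := trivializationAt E (TangentSpace I : M → Type _) p
  let b := Module.finBasis ℝ E
  have hp : p ∈ t.baseSet := FiberBundle.mem_baseSet_trivializationAt E _ p
  have ht : t.baseSet ∈ 𝓝 p := t.open_baseSet.mem_nhds hp
  choose e he heq using fun i ↦
    exists_contMDiff_eventuallyEq ht (t.contMDiffOn_localFrame_baseSet (I := I) ∞ b i)
  -- The frame coefficients of `Z` solve the linear system with Gram matrix `G` and right-hand side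
  -- `F` from the Koszul formula; Cramer's rule makes them smooth.
  let G : M → Matrix _ _ ℝ := fun q ↦ Matrix.gram ℝ (fun i ↦ e i q)
  let F : M → _ → ℝ := fun q i ↦ koszul X Y (e i) q
  have hG (i j) : CMDiffAt ∞ (fun q ↦ G q i j) p := contMDiff_inner (he i) (he j) p
  have hF (i) : CMDiffAt ∞ (fun q ↦ F q i) p := contMDiff_koszul hX hY (he i) p
  have hdet : (G p).det ≠ 0 := by
    refine Matrix.det_gram_ne_zero_iff_linearIndependent.2 ?_
    have : (fun i ↦ e i p) = t.basisAt b hp := by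
      funext i
      rw [(heq i).self_of_nhds, t.localFrame_apply_of_mem_baseSet b hp]
    rw [this]
    exact (t.basisAt b hp).linearIndependent
  refine (contMDiffAt_iff_localFrameCoeff (I := I) b hp).2 fun i ↦ ?_
  have main : CMDiffAt ∞ (fun q ↦ (G q).det⁻¹ * (G q).cramer (F q) i) p := by
    refine ContMDiffAt.mul ?_ ?_
    · exact (contMDiffAt_det hG).inv₀ hdet
    · simp only [Matrix.cramer_apply]
      refine contMDiffAt_det fun k l ↦ ?_
      simp only [Matrix.updateCol_apply]
      split_ifs
      · exact hF k
      · exact hG k l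
  refine main.congr_of_eventuallyEq ?_
  filter_upwards [ht, Filter.eventually_all.2 heq, (contMDiffAt_det hG).continuousAt.eventually_ne hdet]
    with q hq hqe hqd
  have hFq : F q = (G q).mulVec fun i ↦ t.localFrameCoeff I b i q (Z q) := by
    funext j
    have h1 : F q j = inner ℝ (Z q) (e j q) :=
      (inner_leviCivita ((hX q).mdifferentiableAt (by simp)) ((hY q).mdifferentiableAt (by simp))
        ((he j q).mdifferentiableAt (by simp))).symm
    rw [h1]
    conv_lhs => rw [t.eq_sum_localFrameCoeff_smul (I := I) (b := b) hq (s := Z), sum_inner]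
    simp only [Matrix.mulVec, dotProduct, G, Matrix.gram_apply, inner_smul_left, hqe]
    refine Finset.sum_congr rfl fun i _ ↦ ?_
    rw [real_inner_comm]
    simp [mul_comm]
  rw [hFq, Matrix.cramer_eq_adjugate_mulVec, Matrix.mulVec_mulVec, Matrix.adjugate_mul,
    Matrix.smul_mulVec, Matrix.one_mulVec]
  simp [hqd, hZ]

section LocalityAndTensoriality

omit [T2Space M] in
theorem leviCivita_congr {Y Y' : Π x : M, TangentSpace I x} {p : M} (hY : MDiffAt (T% Y) p)
    (h : ∀ᶠ q in 𝓝 p, Y' q = Y q) : leviCivita I M Y' p = leviCivita I M Y p :=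
  (leviCivita I M).isCovariantDerivativeOnUniv.congr_of_eventuallyEq
    (hY.congr_of_eventuallyEq (h.mono fun q hq ↦ by simp only [hq])) hY Filter.univ_mem h

omit [T2Space M] in
theorem leviCivita_sub_eq_mlieBracket {X Y : Π x : M, TangentSpace I x} {p : M}
    (hX : MDiffAt (T% X) p) (hY : MDiffAt (T% Y) p) :
    leviCivita I M Y p (X p) - leviCivita I M X p (Y p) = mlieBracket I X Y p :=
  (CovariantDerivative.torsion_eq_zero_iff _).1 leviCivita_torsion hX hY

omit [T2Space M] in
theorem leviCivita_add_apply {Y Y' : Π x : M, TangentSpace I x} {p : M}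
    (hY : MDiffAt (T% Y) p) (hY' : MDiffAt (T% Y') p) (v : TangentSpace I p) :
    leviCivita I M (Y + Y') p v = leviCivita I M Y p v + leviCivita I M Y' p v := by
  rw [(leviCivita I M).isCovariantDerivativeOnUniv.add hY hY']
  rfl

omit [T2Space M] in
theorem leviCivita_smul_apply {f : M → ℝ} {Y : Π x : M, TangentSpace I x} {p : M}
    (hf : MDiffAt f p) (hY : MDiffAt (T% Y) p) (v : TangentSpace I p) :
    leviCivita I M (f • Y) p v = f p • leviCivita I M Y p v + d% f p v • Y p := by
  rw [(leviCivita I M).isCovariantDerivativeOnUniv.leibniz hY hf]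
  rfl

theorem mdifferentiableAt_leviCivita {X Y : Π x : M, TangentSpace I x}
    (hX : CMDiff ∞ (T% X)) (hY : CMDiff ∞ (T% Y)) (p : M) :
    MDiffAt (T% (fun q ↦ leviCivita I M Y q (X q))) p :=
  (contMDiff_leviCivita hX hY p).mdifferentiableAt (by simp)

theorem curvatureField_congr {X Y Z X' Y' Z' : Π x : M, TangentSpace I x} {p : M}
    (hX : CMDiff ∞ (T% X)) (hY : CMDiff ∞ (T% Y)) (hZ : CMDiff ∞ (T% Z))
    (hXX' : ∀ᶠ q in 𝓝 p, X' q = X q) (hYY' : ∀ᶠ q in 𝓝 p, Y' q = Y q)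
    (hZZ' : ∀ᶠ q in 𝓝 p, Z' q = Z q) :
    curvatureField X' Y' Z' p = curvatureField X Y Z p := by
  have hs {W : Π x : M, TangentSpace I x} (hW : CMDiff ∞ (T% W)) (q) : MDiffAt (T% W) q :=
    (hW q).mdifferentiableAt (by simp)
  have hD : ∀ᶠ q in 𝓝 p, leviCivita I M Z' q = leviCivita I M Z q :=
    hZZ'.eventually_nhds.mono fun q hq ↦ leviCivita_congr (hs hZ q) hq
  have h1 := leviCivita_congr (Y' := fun q ↦ leviCivita I M Z' q (Y' q))
    (mdifferentiableAt_leviCivita hY hZ p) (by filter_upwards [hD, hYY'] with q h h'; rw [h, h'])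
  have h2 := leviCivita_congr (Y' := fun q ↦ leviCivita I M Z' q (X' q))
    (mdifferentiableAt_leviCivita hX hZ p) (by filter_upwards [hD, hXX'] with q h h'; rw [h, h'])
  have h3 : mlieBracket I X' Y' p = mlieBracket I X Y p :=
    Filter.EventuallyEq.mlieBracket_vectorField_eq hXX' hYY'
  rw [curvatureField, curvatureField, h1, h2, h3, hD.self_of_nhds, hXX'.self_of_nhds,
    hYY'.self_of_nhds]

omit [T2Space M] in
theorem curvatureField_swap (X Y Z : Π x : M, TangentSpace I x) (p : M) :
    curvatureField X Y Z p = -curvatureField Y X Z p := by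
  rw [curvatureField, curvatureField, mlieBracket_swap_apply, map_neg]
  module

theorem curvatureField_add_left {X X' Y Z : Π x : M, TangentSpace I x}
    (hX : CMDiff ∞ (T% X)) (hX' : CMDiff ∞ (T% X')) (hZ : CMDiff ∞ (T% Z)) (p : M) :
    curvatureField (X + X') Y Z p = curvatureField X Y Z p + curvatureField X' Y Z p := by
  have h := leviCivita_add_apply (mdifferentiableAt_leviCivita hX hZ p)
    (mdifferentiableAt_leviCivita hX' hZ p) (Y p)
  have e : (fun q ↦ leviCivita I M Z q ((X + X') q)) =
      (fun q ↦ leviCivita I M Z q (X q)) + fun q ↦ leviCivita I M Z q (X' q) := by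
    funext q
    simp
  rw [curvatureField, e, h, mlieBracket_add_left ((hX p).mdifferentiableAt (by simp))
    ((hX' p).mdifferentiableAt (by simp)), curvatureField, curvatureField]
  simp only [Pi.add_apply, map_add]
  module

theorem curvatureField_smul_left {f : M → ℝ} {X Y Z : Π x : M, TangentSpace I x}
    (hf : CMDiff ∞ f) (hX : CMDiff ∞ (T% X)) (hZ : CMDiff ∞ (T% Z)) (p : M) :
    curvatureField (f • X) Y Z p = f p • curvatureField X Y Z p := by
  have hf' : MDiffAt f p := (hf p).mdifferentiableAt (by simp)
  have h := leviCivita_smul_apply hf' (mdifferentiableAt_leviCivita hX hZ p) (Y p)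
  have e : (fun q ↦ leviCivita I M Z q ((f • X) q)) =
      f • fun q ↦ leviCivita I M Z q (X q) := by
    funext q
    simp
  rw [curvatureField, e, h, mlieBracket_smul_left hf' ((hX p).mdifferentiableAt (by simp)),
    curvatureField]
  simp only [Pi.smul_apply', map_add, map_smul]
  module

theorem curvatureField_add_right {X Y Z Z' : Π x : M, TangentSpace I x}
    (hX : CMDiff ∞ (T% X)) (hY : CMDiff ∞ (T% Y)) (hZ : CMDiff ∞ (T% Z)) (hZ' : CMDiff ∞ (T% Z'))
    (p : M) :
    curvatureField X Y (Z + Z') p = curvatureField X Y Z p + curvatureField X Y Z' p := by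
  have hs {W : Π x : M, TangentSpace I x} (hW : CMDiff ∞ (T% W)) (q) : MDiffAt (T% W) q :=
    (hW q).mdifferentiableAt (by simp)
  have e (W : Π x : M, TangentSpace I x) : (fun q ↦ leviCivita I M (Z + Z') q (W q)) =
      (fun q ↦ leviCivita I M Z q (W q)) + fun q ↦ leviCivita I M Z' q (W q) :=
    funext fun q ↦ leviCivita_add_apply (hs hZ q) (hs hZ' q) (W q)
  rw [curvatureField, e, e, leviCivita_add_apply (mdifferentiableAt_leviCivita hX hZ p)
    (mdifferentiableAt_leviCivita hX hZ' p), leviCivita_add_apply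
    (mdifferentiableAt_leviCivita hY hZ p) (mdifferentiableAt_leviCivita hY hZ' p),
    leviCivita_add_apply (hs hZ p) (hs hZ' p), curvatureField, curvatureField]
  module

/-- The mixed first-order terms are symmetric in `X` and `Y` and cancel; the second-order terms in
`f` cancel by `mvfderiv_commutator`. -/
theorem curvatureField_smul_right {f : M → ℝ} {X Y Z : Π x : M, TangentSpace I x}
    (hf : CMDiff ∞ f) (hX : CMDiff ∞ (T% X)) (hY : CMDiff ∞ (T% Y)) (hZ : CMDiff ∞ (T% Z))
    (p : M) : curvatureField X Y (f • Z) p = f p • curvatureField X Y Z p := by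
  have hs {W : Π x : M, TangentSpace I x} (hW : CMDiff ∞ (T% W)) (q) : MDiffAt (T% W) q :=
    (hW q).mdifferentiableAt (by simp)
  have hd {g : M → ℝ} (hg : CMDiff ∞ g) (q) : MDiffAt g q := (hg q).mdifferentiableAt (by simp)
  have e (W : Π x : M, TangentSpace I x) : (fun q ↦ leviCivita I M (f • Z) q (W q)) =
      (f • fun q ↦ leviCivita I M Z q (W q)) + (fun q ↦ d% f q (W q)) • Z :=
    funext fun q ↦ leviCivita_smul_apply (hd hf q) (hs hZ q) (W q)
  have key {W W' : Π x : M, TangentSpace I x} (hW : CMDiff ∞ (T% W)) :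
      leviCivita I M (fun q ↦ leviCivita I M (f • Z) q (W q)) p (W' p) =
      f p • leviCivita I M (fun q ↦ leviCivita I M Z q (W q)) p (W' p)
        + d% f p (W' p) • leviCivita I M Z p (W p) + d% f p (W p) • leviCivita I M Z p (W' p)
        + d% (fun q ↦ d% f q (W q)) p (W' p) • Z p := by
    have s1 := contMDiff_leviCivita hW hZ
    have s2 := contMDiff_mvfderiv_apply hf hW
    rw [e, leviCivita_add_apply (hs (hf.smul_section s1) p) (hs (s2.smul_section hZ) p),
      leviCivita_smul_apply (hd hf p) (hs s1 p), leviCivita_smul_apply (hd s2 p) (hs hZ p)]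
    module
  have c := congrArg (· • Z p) (mvfderiv_commutator hf hX hY p)
  rw [curvatureField, key hX, key hY, leviCivita_smul_apply (hd hf p) (hs hZ p), ← c,
    curvatureField]
  module

theorem curvatureField_eq_of_apply_eq {X Y Z X' Y' Z' : Π x : M, TangentSpace I x} {p : M}
    (hX : CMDiff ∞ (T% X)) (hY : CMDiff ∞ (T% Y)) (hZ : CMDiff ∞ (T% Z))
    (hX' : CMDiff ∞ (T% X')) (hY' : CMDiff ∞ (T% Y')) (hZ' : CMDiff ∞ (T% Z'))
    (hXX' : X p = X' p) (hYY' : Y p = Y' p) (hZZ' : Z p = Z' p) :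
    curvatureField X Y Z p = curvatureField X' Y' Z' p := by
  have left {X X' Y Z : Π x : M, TangentSpace I x} (hX : CMDiff ∞ (T% X))
      (hX' : CMDiff ∞ (T% X')) (hZ : CMDiff ∞ (T% Z)) (h : X p = X' p) :
      curvatureField X Y Z p = curvatureField X' Y Z p :=
    eq_of_tensorial (Φ := fun X ↦ curvatureField X Y Z p)
      (fun h h' ↦ curvatureField_add_left h h' hZ p)
      (fun hf h ↦ curvatureField_smul_left hf h hZ p) hX hX' h
  rw [left hX hX' hZ hXX', curvatureField_swap, left hY hY' hZ hYY', ← curvatureField_swap]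
  exact eq_of_tensorial (Φ := fun Z ↦ curvatureField X' Y' Z p)
    (fun h h' ↦ curvatureField_add_right hX' hY' h h' p)
    (fun hf h ↦ curvatureField_smul_right hf hX' hY' h p) hZ hZ' hZZ'

/-- The curvature operator may be computed from any smooth extensions of the vectors. -/
theorem curvatureOp_eq_curvatureField {X Y Z : Π x : M, TangentSpace I x}
    (hX : CMDiff ∞ (T% X)) (hY : CMDiff ∞ (T% Y)) (hZ : CMDiff ∞ (T% Z)) (p : M) :
    curvatureOp p (X p) (Y p) (Z p) = curvatureField X Y Z p := by
  obtain ⟨X', hX', hXe⟩ := exists_contMDiff_extend (X p)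
  obtain ⟨Y', hY', hYe⟩ := exists_contMDiff_extend (Y p)
  obtain ⟨Z', hZ', hZe⟩ := exists_contMDiff_extend (Z p)
  rw [curvatureOp, curvatureField_congr hX' hY' hZ' (hXe.mono fun _ h ↦ h.symm)
    (hYe.mono fun _ h ↦ h.symm) (hZe.mono fun _ h ↦ h.symm)]
  exact curvatureField_eq_of_apply_eq hX' hY' hZ' hX hY hZ (by simpa using hXe.self_of_nhds)
    (by simpa using hYe.self_of_nhds) (by simpa using hZe.self_of_nhds)

end LocalityAndTensoriality

end SmoothConnection

/-! ### From fields to tangent vectors: the Gray identity at a point -/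

section Bundled

open Topology VectorField

variable {E : Type*} [NormedAddCommGroup E] [NormedSpace ℝ E]
  [FiniteDimensional ℝ E] [CompleteSpace E]
  {H : Type*} [TopologicalSpace H] {I : ModelWithCorners ℝ E H}
  {M : Type*} [TopologicalSpace M] [ChartedSpace H M] [IsManifold I ∞ M] [T2Space M]
  [RiemannianBundle (fun x : M ↦ TangentSpace I x)]
  [IsContMDiffRiemannianBundle I ∞ E (fun x : M ↦ TangentSpace I x)]

variable (I M) in
/-- The smooth vector fields. -/
abbrev SmoothField := Cₛ^∞⟮I; E, (TangentSpace I : M → Type _)⟯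

variable (I M) in
/-- The Levi-Civita connection on smooth vector fields. -/
noncomputable def connection : SmoothField I M →ₗ[ℝ] SmoothField I M →ₗ[ℝ] SmoothField I M :=
  LinearMap.mk₂ ℝ
    (fun X Y ↦ ⟨fun q ↦ leviCivita I M Y q (X q), contMDiff_leviCivita X.contMDiff Y.contMDiff⟩)
    (fun X X' Y ↦ by ext q; simp)
    (fun c X Y ↦ by ext q; simp)
    (fun X Y Y' ↦ by
      ext q
      exact leviCivita_add_apply Y.mdifferentiableAt Y'.mdifferentiableAt (X q))
    (fun c X Y ↦ by
      ext q
      have := (leviCivita I M).isCovariantDerivativeOnUniv.smul_const c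
        (Y.mdifferentiableAt (x := q))
      exact congrArg (fun A ↦ A (X q)) this)

variable (I M) in
/-- The metric on smooth vector fields. -/
noncomputable def metric : SmoothField I M →ₗ[ℝ] SmoothField I M →ₗ[ℝ] C^∞⟮I, M; ℝ⟯ :=
  LinearMap.mk₂ ℝ
    (fun X Y ↦ ⟨fun q ↦ inner ℝ (X q) (Y q), contMDiff_inner X.contMDiff Y.contMDiff⟩)
    (fun X X' Y ↦ by ext q; exact inner_add_left (X q) (X' q) (Y q))
    (fun c X Y ↦ by ext q; exact real_inner_smul_left (X q) (Y q) c)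
    (fun X Y Y' ↦ by ext q; exact inner_add_right (X q) (Y q) (Y' q))
    (fun c X Y ↦ by ext q; exact real_inner_smul_right (X q) (Y q) c)

/-- The derivative of a smooth function along a smooth vector field. -/
noncomputable def derivAlong (X : SmoothField I M) (f : C^∞⟮I, M; ℝ⟯) : C^∞⟮I, M; ℝ⟯ :=
  ⟨fun q ↦ d% f q (X q), contMDiff_mvfderiv_apply f.contMDiff X.contMDiff⟩

omit [CompleteSpace E] [RiemannianBundle (fun x : M ↦ TangentSpace I x)]
  [IsContMDiffRiemannianBundle I ∞ E (fun x : M ↦ TangentSpace I x)] in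
theorem exists_smoothField_apply_eq {p : M} (v : TangentSpace I p) :
    ∃ X : SmoothField I M, X p = v := by
  obtain ⟨X, hX, h⟩ := exists_contMDiff_apply_eq v
  exact ⟨⟨X, hX⟩, h⟩

theorem connection_sub_apply (X Y : SmoothField I M) (q : M) :
    (connection I M X Y - connection I M Y X) q = mlieBracket I X Y q :=
  leviCivita_sub_eq_mlieBracket X.mdifferentiableAt Y.mdifferentiableAt

theorem coe_connection_sub (X Y : SmoothField I M) :
    ⇑(connection I M X Y - connection I M Y X) = mlieBracket I X Y :=
  funext (connection_sub_apply X Y)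

-- Vanishing torsion identifies the antisymmetrised connection with the Lie bracket, so the bracket
-- axioms are the Jacobi identity and the commutator of derivations.
variable (I M) in
theorem isLeviCivitaAlgebra :
    IsLeviCivitaAlgebra (connection I M) derivAlong (metric I M) where
  symm X Y := by ext q; exact real_inner_comm (Y q) (X q)
  nondegenerate X h := by
    ext q
    exact inner_self_eq_zero.1 (congrArg (fun f : C^∞⟮I, M; ℝ⟯ ↦ f q) (h X))
  compat X Y Z := by
    ext q
    exact leviCivita_metricCompatible X.mdifferentiableAt Y.mdifferentiableAt Z.mdifferentiableAt
  jacobi X Y Z := by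
    have : IsManifold I (minSmoothness ℝ 3) M :=
      IsManifold.of_le (n := ∞) (by simpa using le_infty 3)
    have two : minSmoothness ℝ 2 ≤ ∞ := by simpa using le_infty 2
    ext q
    rw [ContMDiffSection.coe_add, Pi.add_apply, connection_sub_apply, connection_sub_apply,
      connection_sub_apply, coe_connection_sub, coe_connection_sub, coe_connection_sub]
    exact leibniz_identity_mlieBracket_apply ((X.contMDiff q).of_le two)
      ((Y.contMDiff q).of_le two) ((Z.contMDiff q).of_le two)
  δ_add X f h := by
    ext q
    exact congrArg (fun A ↦ A (X q)) (mvfderiv_fun_add ((f.contMDiff q).mdifferentiableAt (by simp))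
      ((h.contMDiff q).mdifferentiableAt (by simp)))
  δ_zero X := by
    ext q
    change d% (fun _ : M ↦ (0 : ℝ)) q (X q) = 0
    simp [mvfderiv, mfderiv_const]
  commutator X Y f := by
    ext q
    have := mvfderiv_commutator f.contMDiff X.contMDiff Y.contMDiff q
    rw [← connection_sub_apply] at this
    exact this

theorem curv_connection_apply (X Y Z : SmoothField I M) (p : M) :
    curv (connection I M) X Y Z p = curvatureOp p (X p) (Y p) (Z p) := by
  rw [curvatureOp_eq_curvatureField X.contMDiff Y.contMDiff Z.contMDiff, curvatureField,
    ← connection_sub_apply]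
  rfl

/-- Evaluation of smooth functions at a point. -/
noncomputable def evalAt (p : M) : C^∞⟮I, M; ℝ⟯ →ₗ[ℝ] ℝ where
  toFun f := f p
  map_add' _ _ := rfl
  map_smul' _ _ := rfl

theorem evalAt_metric_curv (X Y Z W : SmoothField I M) (p : M) :
    evalAt p (metric I M (curv (connection I M) X Y Z) W) =
      curvatureTensor p (X p) (Y p) (Z p) (W p) := by
  rw [curvatureTensor, ← curv_connection_apply]
  rfl

namespace UnitaryAlmostComplexStructure

variable (𝓙 : UnitaryAlmostComplexStructure I M)

omit [T2Space M] [CompleteSpace E]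
  [IsContMDiffRiemannianBundle I ∞ E (fun x : M ↦ TangentSpace I x)] [FiniteDimensional ℝ E] in
theorem contMDiff_onField {X : Π x : M, TangentSpace I x} (hX : CMDiff ∞ (T% X)) :
    CMDiff ∞ (T% (𝓙.onField X)) :=
  fun q ↦ ContMDiffAt.clm_bundle_apply (b := id) (𝓙.contMDiff_J q) (hX q)

/-- The action of the almost complex structure on smooth vector fields. -/
noncomputable def fieldMap : SmoothField I M →ₗ[ℝ] SmoothField I M where
  toFun X := ⟨𝓙.onField X, 𝓙.contMDiff_onField X.contMDiff⟩
  map_add' X Y := by ext q; exact map_add (𝓙.J q) _ _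
  map_smul' c X := by ext q; exact map_smul (𝓙.J q) _ _

omit [T2Space M] [CompleteSpace E]
  [IsContMDiffRiemannianBundle I ∞ E (fun x : M ↦ TangentSpace I x)] [FiniteDimensional ℝ E] in
theorem fieldMap_apply (X : SmoothField I M) (q : M) : 𝓙.fieldMap X q = 𝓙.J q (X q) := rfl

theorem grayDefect_curv_eq_zero (h : 𝓙.IsHermitian ∨ 𝓙.IsNearlyKahler) (p : M)
    (X Y Z W : SmoothField I M) :
    grayDefect 𝓙.fieldMap
      (fun X Y Z W ↦ evalAt p (metric I M (curv (connection I M) X Y Z) W)) X Y Z W = 0 := by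
  have hJ (X : SmoothField I M) : 𝓙.fieldMap (𝓙.fieldMap X) = -X := by
    ext q
    exact 𝓙.J_J q (X q)
  have hg (X Y : SmoothField I M) :
      metric I M (𝓙.fieldMap X) (𝓙.fieldMap Y) = metric I M X Y := by
    ext q
    exact 𝓙.inner_J_J q (X q) (Y q)
  rcases h with h | h
  · refine (isLeviCivitaAlgebra I M).grayDefect_eq_zero_of_hermitian hJ hg (fun X Y ↦ ?_) _ _ _ _ _
    ext q
    have := h q X Y (X.contMDiff q) (Y.contMDiff q)
    rw [ContMDiffSection.coe_sub, ContMDiffSection.coe_add, ContMDiffSection.coe_add, Pi.sub_apply,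
      Pi.add_apply, Pi.add_apply, fieldMap_apply, fieldMap_apply, connection_sub_apply,
      connection_sub_apply, connection_sub_apply, connection_sub_apply]
    exact this
  · refine (isLeviCivitaAlgebra I M).grayDefect_eq_zero_of_nearlyKahler hJ hg (fun X ↦ ?_) _ _ _ _ _
    ext q
    exact h q X (X.contMDiff q)

/-- The curvature tensor of a Hermitian or nearly Kähler manifold satisfies the Gray identity. -/
theorem isGrayTensor_curvatureTensor (h : 𝓙.IsHermitian ∨ 𝓙.IsNearlyKahler) (p : M) :
    IsGrayTensor (𝓙.J p : TangentSpace I p →ₗ[ℝ] TangentSpace I p) (curvatureTensor p) := by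
  have hs := (isLeviCivitaAlgebra I M).curvatureSymmetries (evalAt p)
  choose F hF using fun v : TangentSpace I p ↦ exists_smoothField_apply_eq (I := I) v
  have ev (X Y Z W : SmoothField I M) := evalAt_metric_curv X Y Z W p
  refine ⟨⟨fun x y z w ↦ ?_, fun x y z w ↦ ?_, fun x y z w ↦ ?_⟩, fun x x' y z w ↦ ?_,
    fun c x y z w ↦ ?_, fun x y z w ↦ ?_⟩
  · simpa only [ev, hF] using hs.skew_left (F x) (F y) (F z) (F w)
  · simpa only [ev, hF] using hs.skew_right (F x) (F y) (F z) (F w)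
  · simpa only [ev, hF] using hs.bianchi (F x) (F y) (F z) (F w)
  -- The chosen extension `F` need not be linear, so additivity and homogeneity rely on
  -- tensoriality.
  · have := curvatureOp_eq_curvatureField ((F x).contMDiff.add_section (F x').contMDiff)
      (F y).contMDiff (F z).contMDiff p
    rw [curvatureField_add_left (F x).contMDiff (F x').contMDiff (F z).contMDiff,
      ← curvatureOp_eq_curvatureField (F x).contMDiff (F y).contMDiff (F z).contMDiff,
      ← curvatureOp_eq_curvatureField (F x').contMDiff (F y).contMDiff (F z).contMDiff,
      Pi.add_apply, hF, hF, hF, hF] at this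
    rw [curvatureTensor, this, inner_add_left]
    rfl
  · have := curvatureOp_eq_curvatureField
      (ContMDiff.smul_section (f := fun _ ↦ c) contMDiff_const (F x).contMDiff)
      (F y).contMDiff (F z).contMDiff p
    rw [curvatureField_smul_left contMDiff_const (F x).contMDiff (F z).contMDiff,
      ← curvatureOp_eq_curvatureField (F x).contMDiff (F y).contMDiff (F z).contMDiff,
      Pi.smul_apply', hF, hF, hF] at this
    rw [curvatureTensor, this, real_inner_smul_left]
    rfl
  · have := 𝓙.grayDefect_curv_eq_zero h p (F x) (F y) (F z) (F w)
    simpa only [grayDefect, ev, hF, fieldMap_apply, ContinuousLinearMap.coe_coe] using this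

end UnitaryAlmostComplexStructure

end Bundled

/-! ### Complex lines and the choice of a unit vector -/

namespace IsGrayTensor

variable {V : Type*} [AddCommGroup V] [Module ℝ V] {J : V →ₗ[ℝ] V} {R : V → V → V → V → ℝ}

/-- The complex curvature operator of a unit vector does not change under unit complex
multiples. -/
theorem complexCurvature_rotate (h : IsGrayTensor J R) (hJ : ∀ x, J (J x) = -x) {a b : ℝ}
    (hab : a ^ 2 + b ^ 2 = 1) (u z w : V) :
    R (a • u + b • J u) (J (a • u + b • J u)) z w = R u (J u) z w := by
  simp only [map_add, map_smul, hJ, h.add_left, h.add₂, h.smul_left, h.smul₂, h.neg₂]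
  linear_combination (R u (J u) z w) * hab + (-b ^ 2) * h.skew_left (J u) u z w
    + a * b / 2 * h.skew_left (J u) (J u) z w - a * b / 2 * h.skew_left u u z w

/-- The complex Jacobi operator of a unit vector does not change under unit complex multiples. -/
theorem complexJacobi_rotate (h : IsGrayTensor J R) (hJ : ∀ x, J (J x) = -x) {a b : ℝ}
    (hab : a ^ 2 + b ^ 2 = 1) (u y w : V) :
    R y (a • u + b • J u) (a • u + b • J u) w
      + R y (J (a • u + b • J u)) (J (a • u + b • J u)) w = R y u u w + R y (J u) (J u) w := by
  simp only [map_add, map_smul, hJ, h.add₂, h.add₃, h.smul₂, h.smul₃, h.neg₂, h.neg₃]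
  linear_combination (R y u u w + R y (J u) (J u) w) * hab

end IsGrayTensor

section ComplexLine

variable {V : Type*} [NormedAddCommGroup V] [InnerProductSpace ℝ V] {J : V →ₗ[ℝ] V}

theorem inner_apply_self_eq_zero (hJ : ∀ x, J (J x) = -x)
    (hg : ∀ x y, inner ℝ (J x) (J y) = inner ℝ x y) (u : V) : inner ℝ u (J u) = 0 := by
  have := hg u (J u)
  rw [hJ, inner_neg_right, real_inner_comm] at this
  linarith

theorem linearIndependent_pair_apply (hJ : ∀ x, J (J x) = -x)
    (hg : ∀ x y, inner ℝ (J x) (J y) = inner ℝ x y) {u : V} (hu : ‖u‖ = 1) :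
    LinearIndependent ℝ ![u, J u] := by
  rw [LinearIndependent.pair_iff]
  intro s t h
  have h0 := inner_apply_self_eq_zero hJ hg u
  have h1 : inner ℝ u u = 1 := by rw [real_inner_self_eq_norm_sq, hu]; norm_num
  have h2 := hg u u
  have e1 := congrArg (inner ℝ u) h
  have e2 := congrArg (inner ℝ (J u)) h
  rw [inner_add_right, real_inner_smul_right, real_inner_smul_right, inner_zero_right] at e1 e2
  rw [real_inner_comm] at e2
  rw [h0, h1] at e1
  rw [h0, h2, h1] at e2
  constructor <;> linarith

theorem finrank_span_pair_apply (hJ : ∀ x, J (J x) = -x)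
    (hg : ∀ x y, inner ℝ (J x) (J y) = inner ℝ x y) {u : V} (hu : ‖u‖ = 1) :
    Module.finrank ℝ (Submodule.span ℝ {u, J u}) = 2 := by
  have := finrank_span_eq_card (linearIndependent_pair_apply hJ hg hu)
  rwa [Matrix.range_cons_cons_empty, Fintype.card_fin] at this

/-- Two unit vectors of a complex line differ by a complex unit. -/
theorem exists_eq_rotate (hJ : ∀ x, J (J x) = -x)
    (hg : ∀ x y, inner ℝ (J x) (J y) = inner ℝ x y) {L : Submodule ℝ V}
    (hL : Module.finrank ℝ L = 2) (hLJ : L.map J = L) {u v : V} (hu : u ∈ L) (hu1 : ‖u‖ = 1)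
    (hv : v ∈ L) (hv1 : ‖v‖ = 1) : ∃ a b : ℝ, a ^ 2 + b ^ 2 = 1 ∧ v = a • u + b • J u := by
  have : Module.Finite ℝ L := Module.finite_of_finrank_pos (by omega)
  have hle : Submodule.span ℝ {u, J u} ≤ L := by
    rw [Submodule.span_le]
    rintro x (rfl | rfl)
    · exact hu
    · exact hLJ ▸ Submodule.mem_map_of_mem hu
  rw [← Submodule.eq_of_le_of_finrank_eq hle (by rw [finrank_span_pair_apply hJ hg hu1, hL]),
    Submodule.mem_span_pair] at hv
  obtain ⟨a, b, rfl⟩ := hv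
  refine ⟨a, b, ?_, rfl⟩
  have h0 := inner_apply_self_eq_zero hJ hg u
  have h1 : inner ℝ u u = 1 := by rw [real_inner_self_eq_norm_sq, hu1]; norm_num
  have h2 : inner ℝ (a • u + b • J u) (a • u + b • J u) = (1 : ℝ) := by
    rw [real_inner_self_eq_norm_sq, hv1]; norm_num
  simp only [inner_add_left, inner_add_right, real_inner_smul_left, real_inner_smul_right, hg,
    h1, h0, real_inner_comm u (J u)] at h2
  linarith

theorem map_span_pair_apply (hJ : ∀ x, J (J x) = -x) (u : V) :
    (Submodule.span ℝ {u, J u}).map J = Submodule.span ℝ {u, J u} := by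
  rw [Submodule.map_span, Set.image_pair, hJ]
  refine le_antisymm (Submodule.span_le.2 ?_) (Submodule.span_le.2 ?_)
  · rintro x (rfl | rfl)
    · exact Submodule.subset_span (by simp)
    · exact neg_mem (Submodule.subset_span (by simp))
  · rintro x (rfl | rfl)
    · exact neg_mem_iff.1 (Submodule.subset_span (by simp))
    · exact Submodule.subset_span (by simp)

theorem exists_mem_norm_eq_one {L : Submodule ℝ V} (hL : Module.finrank ℝ L = 2) :
    ∃ x, x ∈ L ∧ ‖x‖ = 1 := by
  have : Nontrivial L := Module.nontrivial_of_finrank_pos (R := ℝ) (by omega)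
  obtain ⟨x, hx⟩ := exists_ne (0 : L)
  have hx' : ‖(x : V)‖ ≠ 0 := by simpa using hx
  exact ⟨‖(x : V)‖⁻¹ • (x : V), L.smul_mem _ x.2, by simp [norm_smul, hx']⟩

theorem exists_eq_smul_norm_eq_one {x : V} (hx : x ≠ 0) :
    ∃ (r : ℝ) (u : V), ‖u‖ = 1 ∧ x = r • u :=
  have hx' : ‖x‖ ≠ 0 := norm_ne_zero_iff.2 hx
  ⟨‖x‖, ‖x‖⁻¹ • x, by simp [norm_smul, hx'], by simp [smul_smul, hx']⟩

namespace IsGrayTensor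

variable {R : V → V → V → V → ℝ}

/-- Complex lines only give information at unit vectors; the condition is quadratic in `u`, so it
extends by scaling. -/
theorem eq_zero_of_complexCurvature_unit (h : IsGrayTensor J R) (hJ : ∀ x, J (J x) = -x)
    (h0 : ∀ u, ‖u‖ = 1 → ∀ z w, R u (J u) z w = 0) (x y z w : V) : R x y z w = 0 := by
  refine h.eq_zero_of_complexCurvature hJ (fun x z w ↦ ?_) x y z w
  by_cases hx : x = 0
  · simpa [hx] using h.smul_left 0 0 (J 0) z w
  · obtain ⟨r, u, hu, rfl⟩ := exists_eq_smul_norm_eq_one hx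
    rw [map_smul, h.smul_left, h.smul₂, h0 u hu, mul_zero, mul_zero]

theorem eq_zero_of_complexJacobi_unit (h : IsGrayTensor J R) (hJ : ∀ x, J (J x) = -x)
    (h0 : ∀ u, ‖u‖ = 1 → ∀ y w, R y u u w + R y (J u) (J u) w = 0) (x y z w : V) :
    R x y z w = 0 := by
  refine h.eq_zero_of_complexJacobi hJ (fun x y w ↦ ?_) x y z w
  by_cases hx : x = 0
  · have := h.smul₂ 0 y 0 0 w
    rw [zero_smul, zero_mul] at this
    rw [hx, map_zero, this, add_zero]
  · obtain ⟨r, u, hu, rfl⟩ := exists_eq_smul_norm_eq_one hx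
    rw [map_smul, h.smul₂, h.smul₃, h.smul₂, h.smul₃]
    linear_combination r ^ 2 * h0 u hu y w

end IsGrayTensor

end ComplexLine

/-! ### The operators of a complex line in terms of the curvature tensor -/

section Comparison

variable {E : Type*} [NormedAddCommGroup E] [NormedSpace ℝ E]
  [FiniteDimensional ℝ E] [CompleteSpace E]
  {H : Type*} [TopologicalSpace H] {I : ModelWithCorners ℝ E H}
  {M : Type*} [TopologicalSpace M] [ChartedSpace H M] [IsManifold I ∞ M]
  [RiemannianBundle (fun x : M ↦ TangentSpace I x)]
  [IsContMDiffRiemannianBundle I ∞ E (fun x : M ↦ TangentSpace I x)]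

namespace UnitaryAlmostComplexStructure

variable {𝓙 : UnitaryAlmostComplexStructure I M} {p : M} {L : Submodule ℝ (TangentSpace I p)}

omit [FiniteDimensional ℝ E] [CompleteSpace E]
  [IsContMDiffRiemannianBundle I ∞ E (fun x : M ↦ TangentSpace I x)] in
theorem IsComplexLine.unitVector_spec (hL : 𝓙.IsComplexLine p L) :
    unitVector L ∈ L ∧ ‖unitVector L‖ = 1 :=
  Classical.epsilon_spec (exists_mem_norm_eq_one hL.1)

omit [FiniteDimensional ℝ E] [CompleteSpace E]
  [IsContMDiffRiemannianBundle I ∞ E (fun x : M ↦ TangentSpace I x)] in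
theorem isComplexLine_span {u : TangentSpace I p} (hu : ‖u‖ = 1) :
    𝓙.IsComplexLine p (Submodule.span ℝ {u, 𝓙.J p u}) :=
  ⟨finrank_span_pair_apply (J := (𝓙.J p : TangentSpace I p →ₗ[ℝ] TangentSpace I p)) (𝓙.J_J p)
    (𝓙.inner_J_J p) hu,
   map_span_pair_apply (J := (𝓙.J p : TangentSpace I p →ₗ[ℝ] TangentSpace I p)) (𝓙.J_J p) u⟩

omit [FiniteDimensional ℝ E] [CompleteSpace E]
  [IsContMDiffRiemannianBundle I ∞ E (fun x : M ↦ TangentSpace I x)] in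
theorem IsComplexLine.exists_unitVector_eq (hL : 𝓙.IsComplexLine p L) {u : TangentSpace I p}
    (hu : u ∈ L) (hu1 : ‖u‖ = 1) :
    ∃ a b : ℝ, a ^ 2 + b ^ 2 = 1 ∧ unitVector L = a • u + b • 𝓙.J p u :=
  exists_eq_rotate (J := (𝓙.J p : TangentSpace I p →ₗ[ℝ] TangentSpace I p)) (𝓙.J_J p)
    (𝓙.inner_J_J p) hL.1 hL.2 hu hu1 hL.unitVector_spec.1 hL.unitVector_spec.2

/-- Frees the operator from the arbitrary choice made by `unitVector`, using invariance under
rotation in the line. -/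
theorem IsComplexLine.inner_complexCurvatureOp (hL : 𝓙.IsComplexLine p L)
    (hR : IsGrayTensor (𝓙.J p : TangentSpace I p →ₗ[ℝ] TangentSpace I p) (curvatureTensor p))
    {u : TangentSpace I p} (hu : u ∈ L) (hu1 : ‖u‖ = 1)
    (z w : TangentSpace I p) :
    inner ℝ (𝓙.complexCurvatureOp p L z) w = curvatureTensor p u (𝓙.J p u) z w := by
  obtain ⟨a, b, hab, h⟩ := hL.exists_unitVector_eq hu hu1
  rw [complexCurvatureOp, h]
  exact hR.complexCurvature_rotate (𝓙.J_J p) hab u z w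

theorem IsComplexLine.inner_complexJacobiOp (hL : 𝓙.IsComplexLine p L)
    (hR : IsGrayTensor (𝓙.J p : TangentSpace I p →ₗ[ℝ] TangentSpace I p) (curvatureTensor p))
    {u : TangentSpace I p} (hu : u ∈ L) (hu1 : ‖u‖ = 1)
    (y w : TangentSpace I p) :
    inner ℝ (𝓙.complexJacobiOp p L y) w =
      curvatureTensor p y u u w + curvatureTensor p y (𝓙.J p u) (𝓙.J p u) w := by
  obtain ⟨a, b, hab, h⟩ := hL.exists_unitVector_eq hu hu1
  rw [complexJacobiOp, h, inner_add_left]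
  exact hR.complexJacobi_rotate (𝓙.J_J p) hab u y w

end UnitaryAlmostComplexStructure

end Comparison

end AlmostHermitian

/-! ### The equivalence -/

theorem theorem1p2 {m₁ m₂ : ℕ}
    {M₁ : Type*} [TopologicalSpace M₁] [T2Space M₁]
    [ChartedSpace (EuclideanSpace ℝ (Fin m₁)) M₁] [IsManifold (𝓡 m₁) ∞ M₁]
    [RiemannianBundle (fun x : M₁ ↦ TangentSpace (𝓡 m₁) x)]
    [IsContMDiffRiemannianBundle (𝓡 m₁) ∞ (EuclideanSpace ℝ (Fin m₁))
      (fun x : M₁ ↦ TangentSpace (𝓡 m₁) x)]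
    {M₂ : Type*} [TopologicalSpace M₂] [T2Space M₂]
    [ChartedSpace (EuclideanSpace ℝ (Fin m₂)) M₂] [IsManifold (𝓡 m₂) ∞ M₂]
    [RiemannianBundle (fun x : M₂ ↦ TangentSpace (𝓡 m₂) x)]
    [IsContMDiffRiemannianBundle (𝓡 m₂) ∞ (EuclideanSpace ℝ (Fin m₂))
      (fun x : M₂ ↦ TangentSpace (𝓡 m₂) x)]
    (J₁ : AlmostHermitian.UnitaryAlmostComplexStructure (𝓡 m₁) M₁)
    (J₂ : AlmostHermitian.UnitaryAlmostComplexStructure (𝓡 m₂) M₂)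
    (h₁ : J₁.IsHermitian ∨ J₁.IsNearlyKahler) (h₂ : J₂.IsHermitian ∨ J₂.IsNearlyKahler)
    (P : M₁) (Q : M₂) (θ : TangentSpace (𝓡 m₁) P ≃ₗᵢ[ℝ] TangentSpace (𝓡 m₂) Q)
    (hθ : ∀ v, θ (J₁.J P v) = J₂.J Q (θ v)) :
    [∀ L : Submodule ℝ (TangentSpace (𝓡 m₁) P), J₁.IsComplexLine P L → ∀ v,
        θ (J₁.complexJacobiOp P L v) =
          J₂.complexJacobiOp Q (L.map θ.toLinearEquiv.toLinearMap) (θ v),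
      ∀ L : Submodule ℝ (TangentSpace (𝓡 m₁) P), J₁.IsComplexLine P L → ∀ v,
        θ (J₁.complexCurvatureOp P L v) =
          J₂.complexCurvatureOp Q (L.map θ.toLinearEquiv.toLinearMap) (θ v),
      ∀ x y z w : TangentSpace (𝓡 m₁) P,
        AlmostHermitian.curvatureTensor Q (θ x) (θ y) (θ z) (θ w) =
          AlmostHermitian.curvatureTensor P x y z w].TFAE := by
  have G₁ := J₁.isGrayTensor_curvatureTensor h₁ P
  have G₂ := J₂.isGrayTensor_curvatureTensor h₂ Q
  have hJ₁ := J₁.J_J P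
  have hD := (G₂.comp θ.toLinearEquiv.toLinearMap hθ).sub G₁
  have hline {L : Submodule ℝ (TangentSpace (𝓡 m₁) P)} (hL : J₁.IsComplexLine P L) :
      J₂.IsComplexLine Q (L.map θ.toLinearEquiv.toLinearMap) := by
    refine ⟨by rw [LinearEquiv.finrank_map_eq, hL.1], ?_⟩
    conv_rhs => rw [← hL.2]
    rw [← Submodule.map_comp, ← Submodule.map_comp]
    congr 1
    ext v
    exact (hθ v).symm
  have hmem {L : Submodule ℝ (TangentSpace (𝓡 m₁) P)} {u : TangentSpace (𝓡 m₁) P} (hu : u ∈ L) :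
      θ u ∈ L.map θ.toLinearEquiv.toLinearMap := Submodule.mem_map_of_mem hu
  have ext_iff (a : TangentSpace (𝓡 m₁) P) (b : TangentSpace (𝓡 m₂) Q) :
      θ a = b ↔ ∀ w, inner ℝ a w = inner ℝ b (θ w) := by
    refine ⟨fun h w ↦ by rw [← h, θ.inner_map_map], fun h ↦ ext_inner_right ℝ fun w ↦ ?_⟩
    obtain ⟨w, rfl⟩ := θ.surjective w
    rw [θ.inner_map_map, h]
  have n (u : TangentSpace (𝓡 m₁) P) (hu : ‖u‖ = 1) : ‖θ u‖ = 1 := by rw [θ.norm_map, hu]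
  have hspan (u : TangentSpace (𝓡 m₁) P) : u ∈ Submodule.span ℝ {u, J₁.J P u} :=
    Submodule.subset_span (by simp)
  tfae_have 1 → 3 := fun h x y z w ↦ by
    refine sub_eq_zero.1 (hD.eq_zero_of_complexJacobi_unit hJ₁ (fun u hu y w ↦ ?_) x y z w)
    have hL := J₁.isComplexLine_span hu
    have key := (ext_iff _ _).1 (h _ hL y) w
    rw [hL.inner_complexJacobiOp G₁ (hspan u) hu,
      (hline hL).inner_complexJacobiOp G₂ (hmem (hspan u)) (n u hu), ← hθ] at key
    change AlmostHermitian.curvatureTensor Q (θ y) (θ u) (θ u) (θ w)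
        - AlmostHermitian.curvatureTensor P y u u w
      + (AlmostHermitian.curvatureTensor Q (θ y) (θ (J₁.J P u)) (θ (J₁.J P u)) (θ w)
        - AlmostHermitian.curvatureTensor P y (J₁.J P u) (J₁.J P u) w) = 0
    linarith
  tfae_have 2 → 3 := fun h x y z w ↦ by
    refine sub_eq_zero.1 (hD.eq_zero_of_complexCurvature_unit hJ₁ (fun u hu z w ↦ ?_) x y z w)
    have hL := J₁.isComplexLine_span hu
    have key := (ext_iff _ _).1 (h _ hL z) w
    rw [hL.inner_complexCurvatureOp G₁ (hspan u) hu,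
      (hline hL).inner_complexCurvatureOp G₂ (hmem (hspan u)) (n u hu), ← hθ] at key
    exact sub_eq_zero.2 key.symm
  tfae_have 3 → 1 := fun h L hL v ↦ by
    obtain ⟨hu, hu1⟩ := hL.unitVector_spec
    refine (ext_iff _ _).2 fun w ↦ ?_
    -- `unitVector` of the image line may differ from `θ` of `unitVector L`, but either unit vector
    -- computes the operator.
    rw [hL.inner_complexJacobiOp G₁ hu hu1,
      (hline hL).inner_complexJacobiOp G₂ (hmem hu) (n _ hu1), ← hθ, h, h]
  tfae_have 3 → 2 := fun h L hL v ↦ by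
    obtain ⟨hu, hu1⟩ := hL.unitVector_spec
    refine (ext_iff _ _).2 fun w ↦ ?_
    rw [hL.inner_complexCurvatureOp G₁ hu hu1,
      (hline hL).inner_complexCurvatureOp G₂ (hmem hu) (n _ hu1), ← hθ, h]
  tfae_finish
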